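/- Let $M,N\in[-\infty,\infty]$ with $-M<N$, put $E=(-M,N)\subseteq\mathbb R$, and let $a,b:E\to\mathbb R$ be continuous with $a>0$ on $E$. Fix $c\in E$, let $C(x)=\int_c^x \frac{b}{a}$, and let $$\mu(dx)=\frac{e^{C(x)}}{a(x)}\,dx,\qquad \nu(dx)=e^{-C(x)}\,dx\qquad\text{on }E .$$ Put $D(f)=\int_E (f')^2e^{C}\,dx\in[0,\infty]$ and $\|f\|^2=\int_E f^2\,d\mu$. Let $\mathscr A$ be the set of functions on $E$ that are absolutely continuous on every compact subinterval of $E$, let $\mathscr A_0$ be the set of those $f\in\mathscr A$ with compact support in $E$, and define $$\lambda^{\mathrm{DD}}=\inf\{D(f): f\in\mathscr A_0,\ \|f\|=1\},\qquad \lambda^{\mathrm{NN}}=\inf\Big\{D(f): f\in\mathscr A,\ f\in L^1(\mu),\ \int_E f\,d\mu=0,\ \|f\|=1\Big\}.$$ Let $\mathscr C_+$ be the set of continuous $f:E\to(0,\infty)$. For $f\in\mathscr C_+$ and $\theta\in E$ put $$h^-_{f,\theta}(z)=\int_{-M}^{z}\nu(dx)\int_x^{\theta} f\,d\mu\quad(z\le\theta),\qquad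 h^+_{f,\theta}(z)=\int_{z}^{N}\nu(dx)\int_\theta^{x} f\,d\mu\quad(z\ge\theta).$$ These take values in $[0,\infty]$; call $f$ admissible if $h^-_{f,\theta}(\theta)<\infty$ and $h^+_{f,\theta}(\theta)<\infty$ for some $\theta\in E$. (1) Assume $\nu(E)<\infty$. Then for every admissible $f\in\mathscr C_+$ there is exactly one $\theta=\theta(f)\in E$ with $h^-_{f,\theta}(\theta)=h^+_{f,\theta}(\theta)<\infty$, and $$\lambda^{\mathrm{DD}}=\sup_{f}\ \min\Big\{\inf_{z\in(-M,\theta(f))}\Big(\frac{h^-_{f,\theta(f)}(z)}{f(z)}\Big)^{-1},\ \inf_{z\in(\theta(f),N)}\Big(\frac{h^+_{f,\theta(f)}(z)}{f(z)}\Big)^{-1}\Big\},$$ where the supremum is over all admissible $f\in\mathscr C_+$. (2) Assume $\mu(E)<\infty$. Then the assertions of (1) hold with $\lambda^{\mathrm{DD}}$ replaced by $\lambda^{\mathrm{NN}}$, provided that $\mu$ and $\nu$ are exchanged in the definition of $h^\pm$ (and hence in those of admissibility and of $\theta(f)$); $\lambda^{\mathrm{NN}}$ itself is unchanged. -/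

import Mathlib

open MeasureTheory Set
open scoped ENNReal

noncomputable section

namespace OneDimDiffusion

/-- The open interval `(-M, N)` of real numbers, where `M` and `N` may be infinite. -/
def E (M N : EReal) : Set ℝ :=
  {x : ℝ | -M < (x : EReal) ∧ (x : EReal) < N}

/-- `C(x) = ∫_c^x b / a`, with reference point `c`. -/
def C (a b : ℝ → ℝ) (c x : ℝ) : ℝ :=
  ∫ u in c..x, b u / a u

/-- The speed measure `μ(dx) = (e^{C(x)} / a(x)) dx` on `(-M, N)`. -/
def speedMeasure (M N : EReal) (a b : ℝ → ℝ) (c : ℝ) : Measure ℝ :=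
  (volume.restrict (E M N)).withDensity fun x => ENNReal.ofReal (Real.exp (C a b c x) / a x)

/-- The scale measure `ν(dx) = e^{-C(x)} dx` on `(-M, N)`. -/
def scaleMeasure (M N : EReal) (a b : ℝ → ℝ) (c : ℝ) : Measure ℝ :=
  (volume.restrict (E M N)).withDensity fun x => ENNReal.ofReal (Real.exp (-C a b c x))

/-- The (locally) absolutely continuous functions on `(-M, N)`. -/
def AC (M N : EReal) : Set (ℝ → ℝ) :=
  {f | ∀ x ∈ E M N, ∀ y ∈ E M N, AbsolutelyContinuousOnInterval f x y}

/-- The absolutely continuous functions with compact support in `(-M, N)`. -/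
def AC₀ (M N : EReal) : Set (ℝ → ℝ) :=
  {f | f ∈ AC M N ∧ ∃ K : Set ℝ, IsCompact K ∧ K ⊆ E M N ∧ ∀ x ∈ E M N \ K, f x = 0}

/-- The Dirichlet energy `D(f) = ∫_{-M}^N f'² e^C`, possibly infinite. -/
def energy (M N : EReal) (a b : ℝ → ℝ) (c : ℝ) (f : ℝ → ℝ) : ℝ≥0∞ :=
  ∫⁻ x in E M N, ENNReal.ofReal (deriv f x ^ 2 * Real.exp (C a b c x))

/-- `‖f‖²` in `L²(μ)`, possibly infinite. -/
def normSq (μ : Measure ℝ) (f : ℝ → ℝ) : ℝ≥0∞ :=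
  ∫⁻ x, ENNReal.ofReal (f x ^ 2) ∂μ

/-- `λ^{DD}`: both boundary points are Dirichlet. -/
def lambdaDD (M N : EReal) (a b : ℝ → ℝ) (c : ℝ) : ℝ≥0∞ :=
  sInf {r | ∃ f ∈ AC₀ M N, normSq (speedMeasure M N a b c) f = 1 ∧ r = energy M N a b c f}

/-- `λ^{NN}`: both boundary points are Neumann. -/
def lambdaNN (M N : EReal) (a b : ℝ → ℝ) (c : ℝ) : ℝ≥0∞ :=
  sInf {r | ∃ f ∈ AC M N,
    (Integrable f (speedMeasure M N a b c) ∧ ∫ x, f x ∂(speedMeasure M N a b c) = 0) ∧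
    normSq (speedMeasure M N a b c) f = 1 ∧ r = energy M N a b c f}

/-- The continuous functions on `(-M, N)` that are positive there. -/
def CPlus (M N : EReal) : Set (ℝ → ℝ) :=
  {f | ContinuousOn f (E M N) ∧ ∀ x ∈ E M N, 0 < f x}

/-- `h⁻(z) = ∫_{-M}^z ν(dx) ∫_x^θ f dμ` for `z ≤ θ`
(the measures used below are carried by `(-M, N)`). -/
def hMinus (μ ν : Measure ℝ) (f : ℝ → ℝ) (θ z : ℝ) : ℝ≥0∞ :=
  ∫⁻ x in Iio z, (∫⁻ y in Ioo x θ, ENNReal.ofReal (f y) ∂μ) ∂ν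

/-- `h⁺(z) = ∫_z^N ν(dx) ∫_θ^x f dμ` for `z ≥ θ`
(the measures used below are carried by `(-M, N)`). -/
def hPlus (μ ν : Measure ℝ) (f : ℝ → ℝ) (θ z : ℝ) : ℝ≥0∞ :=
  ∫⁻ x in Ioi z, (∫⁻ y in Ioo θ x, ENNReal.ofReal (f y) ∂μ) ∂ν

/-- `h_f^± < ∞`. Finiteness does not depend on the splitting point `s` in `(-M, N)`. -/
def HFinite (M N : EReal) (μ ν : Measure ℝ) (f : ℝ → ℝ) : Prop :=
  ∃ s ∈ E M N, hMinus μ ν f s s < ∞ ∧ hPlus μ ν f s s < ∞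

/-- `θ` is a root in `(-M, N)` of `h⁻(θ) = h⁺(θ)`, both sides being finite. -/
def IsMatchingPoint (M N : EReal) (μ ν : Measure ℝ) (f : ℝ → ℝ) (θ : ℝ) : Prop :=
  θ ∈ E M N ∧ hMinus μ ν f θ θ = hPlus μ ν f θ θ ∧ hMinus μ ν f θ θ < ∞

/-- `II⁻(f) = h⁻ / f`. -/
def IIMinus (μ ν : Measure ℝ) (f : ℝ → ℝ) (θ z : ℝ) : ℝ≥0∞ :=
  hMinus μ ν f θ z / ENNReal.ofReal (f z)

/-- `II⁺(f) = h⁺ / f`. -/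
def IIPlus (μ ν : Measure ℝ) (f : ℝ → ℝ) (θ z : ℝ) : ℝ≥0∞ :=
  hPlus μ ν f θ z / ENNReal.ofReal (f z)

/-- `[inf_{z ∈ (-M, θ)} II⁻(f)(z)⁻¹] ∧ [inf_{z ∈ (θ, N)} II⁺(f)(z)⁻¹]`. -/
def variationalValue (M N : EReal) (μ ν : Measure ℝ) (f : ℝ → ℝ) (θ : ℝ) : ℝ≥0∞ :=
  min (⨅ z ∈ E M N ∩ Iio θ, (IIMinus μ ν f θ z)⁻¹)
    (⨅ z ∈ E M N ∩ Ioi θ, (IIPlus μ ν f θ z)⁻¹)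

/-- The supremum over the positive continuous `f` with `h_f^± < ∞` of the variational value at
the matching point `θ(f)`. -/
def variationalSup (M N : EReal) (μ ν : Measure ℝ) : ℝ≥0∞ :=
  ⨆ f ∈ CPlus M N, ⨆ θ : ℝ, ⨆ _ : IsMatchingPoint M N μ ν f θ, variationalValue M N μ ν f θ

end OneDimDiffusion

end

/-!
Write `p` and `q` for the densities of the speed measure `μ` and the scale measure `ν`, and `I`
for the interval. The Dirichlet eigenvalue belongs to the operator `u ↦ (u' / q)' / p`, and the
second assertion is treated as the first one with `p` and `q` exchanged (`Weights`).

**The matching point.** Let `P` be a primitive of `f p`. The difference `h⁻ θ - h⁺ θ` equals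
`∫ q (P θ - P)`, so `θ` is a matching point precisely when `P θ` is the `ν`-average of `P`; the
strictly increasing continuous function `P` takes this value exactly once
(`IsPrimitive.existsUnique_matching`). For this `θ` the functions `h⁻` and `h⁺` fit together to
one `C¹` function `h` on `I` (`matchFun`) with `(h' / q)' = - f p` and zero boundary values.

**Every admissible `f` gives a lower bound.** If `lam h ≤ f`, then `ψ = h' / (q h)` satisfies
`ψ' ≤ - lam p - q ψ²`, hence `(g² ψ)' ≤ g'² / q - lam p g²` for every absolutely continuous `g`
(`IsMatched.barta`). For `g` of compact support, integration gives the Dirichlet bound. In the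
Neumann case, with `p` and `q` exchanged, the estimate is applied to the primitive `G` of `g q`,
where `g` has `∫ g q = 0`. There the boundary terms are dominated by the tails of `∫ q g²`, so
that `lam ∫ p G² ≤ ∫ q g²` (`IsMatched.dual_bound`), and `∫ q g² = - ∫ g' G` then bounds the
energy from below (`IsMatched.neumann_bound`).

**The supremum reaches the eigenvalue.** Let `lam` lie below the eigenvalue. A solution of
`(u' / q)' = - lam p u` that is positive between two zeros would yield a test function with Rayleigh
quotient at most `lam`: in the Dirichlet case `u` itself, extended by zero
(`exists_dirichlet_test`), in the Neumann case `v = u' / q`, extended by constants and centred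
(`exists_neumann_test`). So the equation does not oscillate, and a shooting argument produces a
solution `u` that is positive on all of `I` (`NonOscillating.exists_pos_solution`). It is
admissible, and for `f = u` one has `lam h ≤ u`, since `lam h - u` is monotone and `h` vanishes at
the end points (`IsMatched.mul_matchFun_le`).
-/

namespace OneDimDiffusion

open Filter Topology

/-! ### Weights on an open interval -/

/-- A pair of positive continuous weights `p`, `q` on a nonempty open interval `I`. The operator
attached to it is `u ↦ (u' / q)' / p`: here `p` is the density of the speed measure and `q` that
of the scale measure, and exchanging the two measures exchanges `p` and `q`. -/
structure Weights (I : Set ℝ) (p q : ℝ → ℝ) : Prop where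
  isOpen : IsOpen I
  ordConnected : I.OrdConnected
  nonempty : I.Nonempty
  contLeft : ContinuousOn p I
  contRight : ContinuousOn q I
  posLeft : ∀ x ∈ I, 0 < p x
  posRight : ∀ x ∈ I, 0 < q x

variable {I : Set ℝ} {p q : ℝ → ℝ}

theorem Weights.swap (h : Weights I p q) : Weights I q p :=
  ⟨h.isOpen, h.ordConnected, h.nonempty, h.contRight, h.contLeft, h.posRight, h.posLeft⟩

theorem exists_mem_lt_of_isOpen (hI : IsOpen I) {x : ℝ} (hx : x ∈ I) : ∃ y ∈ I, y < x := by
  obtain ⟨ε, hε, h⟩ := Metric.isOpen_iff.1 hI x hx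
  exact ⟨x - ε / 2, h (by simp [abs_of_pos hε]; linarith), by linarith⟩

theorem exists_mem_gt_of_isOpen (hI : IsOpen I) {x : ℝ} (hx : x ∈ I) : ∃ y ∈ I, x < y := by
  obtain ⟨ε, hε, h⟩ := Metric.isOpen_iff.1 hI x hx
  exact ⟨x + ε / 2, h (by simp [abs_of_pos hε]; linarith), by linarith⟩

/-- An open interval is exhausted by an increasing sequence of compact intervals. -/
theorem exists_exhaustion (hI : IsOpen I) {c : ℝ} (hc : c ∈ I) :
    ∃ α β : ℕ → ℝ, Antitone α ∧ Monotone β ∧ (∀ n, α n ∈ I) ∧ (∀ n, β n ∈ I) ∧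
      (∀ n, α n ≤ c) ∧ (∀ n, c ≤ β n) ∧ ∀ x ∈ I, ∃ n, α n < x ∧ x < β n := by
  obtain ⟨F, hFc, hFI, hFU, hFm⟩ := hI.exists_iUnion_isClosed
  let K : ℕ → Set ℝ := fun n => insert c (F n ∩ Metric.closedBall c n)
  have hKc : ∀ n, IsCompact (K n) := fun n =>
    ((isCompact_closedBall c n).inter_left (hFc n)).insert c
  have hKn : ∀ n, (K n).Nonempty := fun n => ⟨c, mem_insert _ _⟩
  have hKI : ∀ n, K n ⊆ I := fun n => insert_subset hc (inter_subset_left.trans (hFI n))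
  have hKm : Monotone K := fun m n hmn => insert_subset_insert
    (inter_subset_inter (hFm hmn) (Metric.closedBall_subset_closedBall (by exact_mod_cast hmn)))
  refine ⟨fun n => sInf (K n), fun n => sSup (K n), ?_, ?_,
    fun n => hKI n ((hKc n).sInf_mem (hKn n)), fun n => hKI n ((hKc n).sSup_mem (hKn n)),
    fun n => csInf_le (hKc n).bddBelow (mem_insert _ _),
    fun n => le_csSup (hKc n).bddAbove (mem_insert _ _), fun x hx => ?_⟩
  · exact fun m n hmn => csInf_le_csInf (hKc n).bddBelow (hKn m) (hKm hmn)
  · exact fun m n hmn => csSup_le_csSup (hKc n).bddAbove (hKn m) (hKm hmn)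
  · have hmem : ∀ y ∈ I, ∃ n, y ∈ K n := fun y hy => by
      rw [← hFU, mem_iUnion] at hy
      obtain ⟨m, hm⟩ := hy
      obtain ⟨k, hk⟩ := exists_nat_ge (dist y c)
      refine ⟨max m k, mem_insert_of_mem _ ⟨hFm (le_max_left m k) hm, ?_⟩⟩
      rw [Metric.mem_closedBall]
      exact hk.trans (by exact_mod_cast le_max_right m k)
    obtain ⟨y, hy, hyx⟩ := exists_mem_lt_of_isOpen hI hx
    obtain ⟨z, hz, hxz⟩ := exists_mem_gt_of_isOpen hI hx
    obtain ⟨m, hm⟩ := hmem y hy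
    obtain ⟨n, hn⟩ := hmem z hz
    exact ⟨max m n, (csInf_le (hKc _).bddBelow (hKm (le_max_left m n) hm)).trans_lt hyx,
      hxz.trans_le (le_csSup (hKc _).bddAbove (hKm (le_max_right m n) hn))⟩

theorem intervalIntegrable_of_continuousOn {F : Type*} [NormedAddCommGroup F]
    (hO : I.OrdConnected) {g : ℝ → F} (hg : ContinuousOn g I) {x y : ℝ} (hx : x ∈ I) (hy : y ∈ I) :
    IntervalIntegrable g volume x y :=
  (hg.mono (hO.uIcc_subset hx hy)).intervalIntegrable

theorem hasDerivAt_integral_of_continuousOn {F : Type*} [NormedAddCommGroup F] [NormedSpace ℝ F]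
    [CompleteSpace F] (hI : IsOpen I) (hO : I.OrdConnected) {g : ℝ → F} (hg : ContinuousOn g I)
    {c x : ℝ} (hc : c ∈ I) (hx : x ∈ I) : HasDerivAt (fun y => ∫ t in c..y, g t) (g x) x := by
  refine intervalIntegral.integral_hasDerivAt_right
    (intervalIntegrable_of_continuousOn hO hg hc hx) ?_ (hg.continuousAt (hI.mem_nhds hx))
  exact hg.stronglyMeasurableAtFilter hI x hx

theorem integral_eq_sub_of_hasDerivAt_on (hO : I.OrdConnected) {F F' : ℝ → ℝ}
    (hF : ∀ x ∈ I, HasDerivAt F (F' x) x) (hF' : ContinuousOn F' I) {x y : ℝ} (hx : x ∈ I)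
    (hy : y ∈ I) : ∫ t in x..y, F' t = F y - F x :=
  intervalIntegral.integral_eq_sub_of_hasDerivAt
    (fun t ht => hF t (hO.uIcc_subset hx hy ht)) (intervalIntegrable_of_continuousOn hO hF' hx hy)

/-! ### Linear differential equations -/

section LinearODE

variable {F : Type*} [NormedAddCommGroup F] [NormedSpace ℝ F]

/-- The terms of the Picard series of the linear equation `y' = A y`, `y c = y₀`. -/
noncomputable def picardTerm (A : ℝ → F →L[ℝ] F) (c : ℝ) (y₀ : F) : ℕ → ℝ → F
  | 0 => fun _ => y₀
  | n + 1 => fun x => ∫ t in c..x, A t (picardTerm A c y₀ n t)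

theorem norm_picardTerm_le (hO : I.OrdConnected) {A : ℝ → F →L[ℝ] F}
    {c x K : ℝ} (hc : c ∈ I) (hx : x ∈ I) (y₀ : F) (n : ℕ)
    (hK : ∀ t ∈ uIcc c x, ‖A t‖ ≤ K) :
    ‖picardTerm A c y₀ n x‖ ≤ ‖y₀‖ * (K * |x - c|) ^ n / n.factorial := by
  have hK0 : 0 ≤ K := (norm_nonneg _).trans (hK c left_mem_uIcc)
  induction n generalizing x with
  | zero => simp [picardTerm]
  | succ n ih =>
    have hsub := hO.uIcc_subset hc hx
    have hb : ∀ t ∈ uIcc c x, ‖A t (picardTerm A c y₀ n t)‖ ≤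
        K * (‖y₀‖ * (K * |t - c|) ^ n / n.factorial) := fun t ht =>
      (A t).le_of_opNorm_le_of_le (hK t ht)
        (ih (hsub ht) fun s hs => hK s (uIcc_subset_uIcc left_mem_uIcc ht hs))
    have hint : |∫ t in c..x, K * (‖y₀‖ * (K * |t - c|) ^ n / n.factorial)| =
        ‖y₀‖ * (K * |x - c|) ^ (n + 1) / (n + 1).factorial := by
      have h1 : ∀ t, K * (‖y₀‖ * (K * |t - c|) ^ n / n.factorial) =
          (K ^ (n + 1) * ‖y₀‖ / n.factorial) * |t - c| ^ n := fun t => by ring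
      have h2 : |∫ t in c..x, |t - c| ^ n| = |x - c| ^ (n + 1) / (n + 1) := by
        rw [intervalIntegral.integral_comp_sub_right (fun t => |t| ^ n) c, sub_self]
        have h3 : |∫ t in (0 : ℝ)..x - c, t ^ n| = |x - c| ^ (n + 1) / (n + 1) := by
          rw [integral_pow, zero_pow n.succ_ne_zero, sub_zero, abs_div, abs_pow,
            abs_of_nonneg (by positivity : (0 : ℝ) ≤ n + 1)]
        rw [← h3]
        rcases le_total 0 (x - c) with h | h
        · congr 1
          refine intervalIntegral.integral_congr fun t ht => ?_
          rw [uIcc_of_le h] at ht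
          simp [abs_of_nonneg ht.1]
        · rw [intervalIntegral.integral_congr (g := fun t => (-1) ^ n * t ^ n)]
          · rw [intervalIntegral.integral_const_mul, abs_mul, abs_pow, abs_neg, abs_one, one_pow,
              one_mul]
          · intro t ht
            rw [uIcc_of_ge h] at ht
            simp only [abs_of_nonpos ht.2, ← mul_pow, neg_one_mul]
      simp only [h1]
      rw [intervalIntegral.integral_const_mul, abs_mul, h2, abs_of_nonneg (by positivity),
        Nat.factorial_succ]
      push_cast
      field_simp
      ring
    rw [← hint]
    refine intervalIntegral.norm_integral_le_abs_of_norm_le ?_ ?_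
    · exact (ae_restrict_mem measurableSet_uIoc).mono fun t ht => hb t (uIoc_subset_uIcc ht)
    · exact (by fun_prop : Continuous _).intervalIntegrable _ _

variable [CompleteSpace F]

theorem continuousOn_picardTerm (hI : IsOpen I) (hO : I.OrdConnected) {A : ℝ → F →L[ℝ] F}
    (hA : ContinuousOn A I) {c : ℝ} (hc : c ∈ I) (y₀ : F) (n : ℕ) :
    ContinuousOn (picardTerm A c y₀ n) I := by
  induction n with
  | zero => exact continuousOn_const
  | succ n ih =>
    intro x hx
    exact (hasDerivAt_integral_of_continuousOn hI hO (hA.clm_apply ih) hc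
      hx).continuousAt.continuousWithinAt

theorem hasDerivAt_picardTerm (hI : IsOpen I) (hO : I.OrdConnected) {A : ℝ → F →L[ℝ] F}
    (hA : ContinuousOn A I) {c x : ℝ} (hc : c ∈ I) (hx : x ∈ I) (y₀ : F) (n : ℕ) :
    HasDerivAt (picardTerm A c y₀ (n + 1)) (A x (picardTerm A c y₀ n x)) x :=
  hasDerivAt_integral_of_continuousOn hI hO
    (hA.clm_apply (continuousOn_picardTerm hI hO hA hc y₀ n)) hc hx

/-- A linear differential equation with continuous coefficients on an open interval has solutions
on the whole interval, for any initial value: the Picard series converges locally uniformly. -/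
theorem exists_linear_ode_solution (hI : IsOpen I) (hO : I.OrdConnected) {A : ℝ → F →L[ℝ] F}
    (hA : ContinuousOn A I) {c : ℝ} (hc : c ∈ I) (y₀ : F) :
    ∃ y : ℝ → F, y c = y₀ ∧ ∀ x ∈ I, HasDerivAt y (A x (y x)) x := by
  have hlocal : ∀ x ∈ I, HasDerivAt (fun z => ∑' n, picardTerm A c y₀ (n + 1) z)
      (∑' n, A x (picardTerm A c y₀ n x)) x ∧ Summable fun n => picardTerm A c y₀ n x := by
    intro x hx
    obtain ⟨α, hαI, hα⟩ : ∃ α ∈ I, α < min c x :=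
      exists_mem_lt_of_isOpen hI (by rcases min_choice c x with h | h <;> rw [h] <;> assumption)
    obtain ⟨β, hβI, hβ⟩ : ∃ β ∈ I, max c x < β :=
      exists_mem_gt_of_isOpen hI (by rcases max_choice c x with h | h <;> rw [h] <;> assumption)
    have hxJ : x ∈ Ioo α β := ⟨hα.trans_le (min_le_right _ _), (le_max_right _ _).trans_lt hβ⟩
    have hcJ : c ∈ Ioo α β := ⟨hα.trans_le (min_le_left _ _), (le_max_left _ _).trans_lt hβ⟩
    have hsub : Icc α β ⊆ I := hO.out hαI hβI
    obtain ⟨K, hK⟩ := isCompact_Icc.exists_bound_of_continuousOn (hA.mono hsub)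
    have hK0 : 0 ≤ K := (norm_nonneg _).trans (hK c (Ioo_subset_Icc_self hcJ))
    have hbound : ∀ n, ∀ y ∈ Ioo α β, ‖picardTerm A c y₀ n y‖ ≤
        ‖y₀‖ * ((K * (β - α)) ^ n / n.factorial) := by
      intro n y hy
      refine (norm_picardTerm_le hO hc (hsub (Ioo_subset_Icc_self hy)) y₀ n (K := K)
        fun t ht => hK t ?_).trans ?_
      · exact uIcc_subset_Icc (Ioo_subset_Icc_self hcJ) (Ioo_subset_Icc_self hy) ht
      · rw [mul_div_assoc]
        have : |y - c| ≤ β - α := abs_le.2 ⟨by linarith [hy.1, hcJ.2], by linarith [hy.2, hcJ.1]⟩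
        gcongr
    have hs : Summable fun n : ℕ => ‖y₀‖ * ((K * (β - α)) ^ n / n.factorial) :=
      (Real.summable_pow_div_factorial _).mul_left _
    have hsum : Summable fun n => picardTerm A c y₀ n x :=
      Summable.of_norm_bounded hs fun n => hbound n x hxJ
    have hsum' : Summable fun n => picardTerm A c y₀ (n + 1) x :=
      (summable_nat_add_iff (f := fun n => picardTerm A c y₀ n x) 1).2 hsum
    refine ⟨hasDerivAt_tsum_of_isPreconnected (g := fun n => picardTerm A c y₀ (n + 1))
      (u := fun n => K * (‖y₀‖ * ((K * (β - α)) ^ n / n.factorial)))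
      (g' := fun n y => A y (picardTerm A c y₀ n y)) (hs.mul_left K) isOpen_Ioo isPreconnected_Ioo
      (fun n y hy => hasDerivAt_picardTerm hI hO hA hc (hsub (Ioo_subset_Icc_self hy)) y₀ n)
      (fun n y hy => (A y).le_of_opNorm_le_of_le (hK y (Ioo_subset_Icc_self hy)) (hbound n y hy))
      hxJ hsum' hxJ, hsum⟩
  refine ⟨fun x => y₀ + ∑' n, picardTerm A c y₀ (n + 1) x, ?_, fun x hx => ?_⟩
  · simp [picardTerm]
  · obtain ⟨hd, hs⟩ := hlocal x hx
    have h1 : y₀ + ∑' n, picardTerm A c y₀ (n + 1) x = ∑' n, picardTerm A c y₀ n x := by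
      rw [hs.tsum_eq_zero_add]; rfl
    beta_reduce
    rw [h1, (A x).map_tsum hs]
    exact hd.const_add y₀

end LinearODE

/-! ### Positive solutions of the eigenvalue equation -/

/-- `u` solves `(u' / q)' = - lam p u` on `I`, written as a first order system with `v = u' / q`. -/
def IsSolution (I : Set ℝ) (p q : ℝ → ℝ) (lam : ℝ) (u v : ℝ → ℝ) : Prop :=
  ∀ x ∈ I, HasDerivAt u (q x * v x) x ∧ HasDerivAt v (-(lam * p x * u x)) x

/-- No solution of `(u' / q)' = - lam p u` is positive between two zeros in `I`. -/
def NonOscillating (I : Set ℝ) (p q : ℝ → ℝ) (lam : ℝ) : Prop :=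
  ∀ u v : ℝ → ℝ, IsSolution I p q lam u v → ∀ α ∈ I, ∀ β ∈ I, α < β → u α = 0 → u β = 0 →
    (∀ x ∈ Ioo α β, 0 < u x) → False

theorem IsSolution.continuousOn {lam : ℝ} {u v : ℝ → ℝ} (h : IsSolution I p q lam u v) :
    ContinuousOn u I ∧ ContinuousOn v I :=
  ⟨fun x hx => (h x hx).1.continuousAt.continuousWithinAt,
    fun x hx => (h x hx).2.continuousAt.continuousWithinAt⟩

theorem IsSolution.add {lam : ℝ} {u v u' v' : ℝ → ℝ} (h : IsSolution I p q lam u v)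
    (h' : IsSolution I p q lam u' v') (s : ℝ) :
    IsSolution I p q lam (fun x => u x + s * u' x) (fun x => v x + s * v' x) := fun x hx =>
  ⟨((h x hx).1.add ((h' x hx).1.const_mul s)).congr_deriv (by ring),
    ((h x hx).2.add ((h' x hx).2.const_mul s)).congr_deriv (by ring)⟩

theorem IsSolution.neg {lam : ℝ} {u v : ℝ → ℝ} (h : IsSolution I p q lam u v) :
    IsSolution I p q lam (fun x => -u x) (fun x => -v x) := fun x hx =>
  ⟨(h x hx).1.neg.congr_deriv (by ring), (h x hx).2.neg.congr_deriv (by ring)⟩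

theorem exists_isSolution (hw : Weights I p q) (lam : ℝ) {c : ℝ} (hc : c ∈ I) (u₀ v₀ : ℝ) :
    ∃ u v : ℝ → ℝ, IsSolution I p q lam u v ∧ u c = u₀ ∧ v c = v₀ := by
  let B₁ : ℝ × ℝ →L[ℝ] ℝ × ℝ :=
    (ContinuousLinearMap.inl ℝ ℝ ℝ).comp (ContinuousLinearMap.snd ℝ ℝ ℝ)
  let B₂ : ℝ × ℝ →L[ℝ] ℝ × ℝ :=
    (ContinuousLinearMap.inr ℝ ℝ ℝ).comp (ContinuousLinearMap.fst ℝ ℝ ℝ)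
  have hA : ContinuousOn (fun x => q x • B₁ + (-(lam * p x)) • B₂) I :=
    (hw.contRight.smul continuousOn_const).add
      ((continuousOn_const.mul hw.contLeft).neg.smul continuousOn_const)
  obtain ⟨y, hy0, hy⟩ := exists_linear_ode_solution hw.isOpen hw.ordConnected hA hc (u₀, v₀)
  refine ⟨fun x => (y x).1, fun x => (y x).2, fun x hx => ⟨?_, ?_⟩, by simp [hy0], by simp [hy0]⟩
  · exact (hasFDerivAt_fst.comp_hasDerivAt x (hy x hx)).congr_deriv (by simp [B₁, B₂])
  · exact (hasFDerivAt_snd.comp_hasDerivAt x (hy x hx)).congr_deriv (by simp [B₁, B₂])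

/-- A solution of a nonoscillating equation which is positive at some point does not become
nonpositive on both sides of it. -/
theorem NonOscillating.false_of_nonpos (hO : I.OrdConnected) {lam : ℝ}
    (hno : NonOscillating I p q lam) {u v : ℝ → ℝ} (hu : IsSolution I p q lam u v) {a m b : ℝ}
    (ha : a ∈ I) (hb : b ∈ I) (ham : a < m) (hmb : m < b) (hua : u a ≤ 0) (hum : 0 < u m)
    (hub : u b ≤ 0) : False := by
  have hm : m ∈ I := hO.out ha hb ⟨ham.le, hmb.le⟩
  have hc := hu.continuousOn.1
  have hcr : ContinuousOn u (Icc m b) := hc.mono (hO.out hm hb)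
  have hcl : ContinuousOn u (Icc a m) := hc.mono (hO.out ha hm)
  -- `β` is the first zero after `m`, and `α` the last zero before `m`.
  have hZr : IsCompact (Icc m b ∩ u ⁻¹' Iic 0) :=
    isCompact_Icc.of_isClosed_subset (hcr.preimage_isClosed_of_isClosed isClosed_Icc isClosed_Iic)
      inter_subset_left
  have hZl : IsCompact (Icc a m ∩ u ⁻¹' Iic 0) :=
    isCompact_Icc.of_isClosed_subset (hcl.preimage_isClosed_of_isClosed isClosed_Icc isClosed_Iic)
      inter_subset_left
  obtain ⟨β, ⟨hβ, hβ0⟩, hβm⟩ := hZr.exists_isLeast ⟨b, ⟨hmb.le, le_rfl⟩, hub⟩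
  obtain ⟨α, ⟨hα, hα0⟩, hαm⟩ := hZl.exists_isGreatest ⟨a, ⟨le_rfl, ham.le⟩, hua⟩
  have hβI : β ∈ I := hO.out hm hb hβ
  have hαI : α ∈ I := hO.out ha hm hα
  have hmβ : m < β := lt_of_le_of_ne hβ.1 (by rintro rfl; exact hum.not_ge hβ0)
  have hαm' : α < m := lt_of_le_of_ne hα.2 (by rintro rfl; exact hum.not_ge hα0)
  have hposr : ∀ x ∈ Ico m β, 0 < u x := fun x hx => by
    by_contra! h
    exact hx.2.not_ge (hβm ⟨⟨hx.1, hx.2.le.trans hβ.2⟩, h⟩)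
  have hposl : ∀ x ∈ Ioc α m, 0 < u x := fun x hx => by
    by_contra! h
    exact hx.1.not_ge (hαm ⟨⟨hα.1.trans hx.1.le, hx.2⟩, h⟩)
  have hβ1 : 0 ≤ u β := by
    refine ge_of_tendsto ((hc β hβI).tendsto.mono_left
      ((nhdsWithin_le_iff (s := Iio β)).2 ?_)) ?_
    · exact mem_of_superset (Ioo_mem_nhdsLT hmβ)
        (Ioo_subset_Icc_self.trans (hO.out hm hβI))
    · exact mem_of_superset (Ioo_mem_nhdsLT hmβ) fun x hx => (hposr x ⟨hx.1.le, hx.2⟩).le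
  have hα1 : 0 ≤ u α := by
    refine ge_of_tendsto ((hc α hαI).tendsto.mono_left
      ((nhdsWithin_le_iff (s := Ioi α)).2 ?_)) ?_
    · exact mem_of_superset (Ioo_mem_nhdsGT hαm')
        (Ioo_subset_Icc_self.trans (hO.out hαI hm))
    · exact mem_of_superset (Ioo_mem_nhdsGT hαm') fun x hx => (hposl x ⟨hx.1, hx.2.le⟩).le
  refine hno u v hu α hαI β hβI (hαm'.trans hmβ) (le_antisymm hα0 hα1) (le_antisymm hβ0 hβ1) ?_
  intro x hx
  rcases le_total x m with h | h
  · exact hposl x ⟨hx.1, h⟩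
  · exact hposr x ⟨h, hx.2⟩

/-- The solution of a nonoscillating equation starting from zero with positive slope has no other
zero. -/
theorem NonOscillating.sign_of_zero (hw : Weights I p q) {lam : ℝ} (hno : NonOscillating I p q lam)
    {u v : ℝ → ℝ} (hu : IsSolution I p q lam u v) {c : ℝ} (hc : c ∈ I) (huc : u c = 0)
    (hvc : v c = 1) : (∀ x ∈ I, c < x → 0 < u x) ∧ ∀ x ∈ I, x < c → u x < 0 := by
  have hd : HasDerivAt u (q c) c := by simpa [hvc] using (hu c hc).1
  have hq := hw.posRight c hc
  constructor
  · intro b hb hcb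
    by_contra! h
    have h1 : ∀ᶠ x in 𝓝[>] c, 0 < u x := by
      have := (hasDerivAt_iff_tendsto_slope.1 hd).mono_left
        (nhdsWithin_mono c (fun x (hx : c < x) => hx.ne'))
      filter_upwards [this.eventually (lt_mem_nhds hq), self_mem_nhdsWithin] with x hx hcx
      rw [slope_def_field, huc, sub_zero] at hx
      exact (div_pos_iff_of_pos_right (sub_pos.2 hcx)).1 hx
    obtain ⟨m, hm, hm'⟩ := (h1.and (Ioo_mem_nhdsGT hcb)).exists
    exact hno.false_of_nonpos hw.ordConnected hu hc hb hm'.1 hm'.2 huc.le hm h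
  · intro a ha hac
    by_contra! h
    have h1 : ∀ᶠ x in 𝓝[<] c, u x < 0 := by
      have := (hasDerivAt_iff_tendsto_slope.1 hd).mono_left
        (nhdsWithin_mono c (fun x (hx : x < c) => hx.ne))
      filter_upwards [this.eventually (lt_mem_nhds hq), self_mem_nhdsWithin] with x hx hcx
      rw [slope_def_field, huc, sub_zero] at hx
      have := mul_neg_of_pos_of_neg hx (sub_neg.2 hcx)
      rwa [div_mul_cancel₀ _ (sub_neg.2 hcx).ne] at this
    obtain ⟨m, hm, hm'⟩ := (h1.and (Ioo_mem_nhdsLT hac)).exists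
    exact hno.false_of_nonpos hw.ordConnected hu.neg ha hc hm'.1 hm'.2 (by simpa using h)
      (by simpa using hm) (by simp [huc])

/-- A nonnegative solution of the eigenvalue equation which does not vanish identically is positive:
at a zero `x₀` the monotone function `v = u' / q` changes sign, so that `u` has a maximum there. -/
theorem IsSolution.pos_of_nonneg (hw : Weights I p q) {lam : ℝ} (hlam : 0 ≤ lam)
    {u v : ℝ → ℝ} (hu : IsSolution I p q lam u v) (h0 : ∀ x ∈ I, 0 ≤ u x) {c : ℝ} (hc : c ∈ I)
    (huc : 0 < u c) : ∀ x ∈ I, 0 < u x := by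
  intro x₀ hx₀
  by_contra! h
  have hux : u x₀ = 0 := le_antisymm h (h0 x₀ hx₀)
  have hmin : IsLocalMin u x₀ :=
    mem_of_superset (hw.isOpen.mem_nhds hx₀) fun x hx => by simpa [hux] using h0 x hx
  have hv0 : v x₀ = 0 := by
    have := hmin.hasDerivAt_eq_zero (hu x₀ hx₀).1
    exact (mul_eq_zero.1 this).resolve_left (hw.posRight x₀ hx₀).ne'
  have hvanti : AntitoneOn v I := by
    refine antitoneOn_of_hasDerivWithinAt_nonpos hw.ordConnected.convex hu.continuousOn.2
      (fun x hx => (hu x (interior_subset hx)).2.hasDerivWithinAt) fun x hx => ?_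
    have hx := interior_subset hx
    have := mul_nonneg (mul_nonneg hlam (hw.posLeft x hx).le) (h0 x hx)
    linarith
  rcases le_total x₀ c with hxc | hcx
  · have hanti : AntitoneOn u (Icc x₀ c) := by
      have hsub := hw.ordConnected.out hx₀ hc
      refine antitoneOn_of_hasDerivWithinAt_nonpos (convex_Icc _ _) (hu.continuousOn.1.mono hsub)
        (fun x hx => (hu x (hsub (interior_subset hx))).1.hasDerivWithinAt) fun x hx => ?_
      have hx := interior_subset hx
      exact mul_nonpos_of_nonneg_of_nonpos (hw.posRight x (hsub hx)).le
        (hv0 ▸ hvanti hx₀ (hsub hx) hx.1)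
    exact huc.not_ge (hux ▸ hanti (left_mem_Icc.2 hxc) (right_mem_Icc.2 hxc) hxc)
  · have hmono : MonotoneOn u (Icc c x₀) := by
      have hsub := hw.ordConnected.out hc hx₀
      refine monotoneOn_of_hasDerivWithinAt_nonneg (convex_Icc _ _) (hu.continuousOn.1.mono hsub)
        (fun x hx => (hu x (hsub (interior_subset hx))).1.hasDerivWithinAt) fun x hx => ?_
      have hx := interior_subset hx
      exact mul_nonneg (hw.posRight x (hsub hx)).le (hv0 ▸ hvanti (hsub hx) hx₀ hx.2)
    exact huc.not_ge (hux ▸ hmono (left_mem_Icc.2 hcx) (right_mem_Icc.2 hcx) hcx)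

/-- A nonoscillating equation has a solution that is positive on the whole interval. With `φ` and
`ψ` the solutions having initial values `(1, 0)` and `(0, 1)` at an interior point `c`, the
nonnegativity of `φ + s ψ` bounds the slope `s` from below at the points to the right of `c` and
from above at the points to the left of `c`; nonoscillation makes these bounds compatible. -/
theorem NonOscillating.exists_pos_solution (hw : Weights I p q) {lam : ℝ} (hlam : 0 ≤ lam)
    (hno : NonOscillating I p q lam) :
    ∃ u v : ℝ → ℝ, IsSolution I p q lam u v ∧ ∀ x ∈ I, 0 < u x := by
  obtain ⟨c, hc⟩ := hw.nonempty
  obtain ⟨φ, φ', hφ, hφc, hφc'⟩ := exists_isSolution hw lam hc 1 0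
  obtain ⟨ψ, ψ', hψ, hψc, hψc'⟩ := exists_isSolution hw lam hc 0 1
  obtain ⟨hψr, hψl⟩ := hno.sign_of_zero hw hψ hc hψc hψc'
  have hle : ∀ x ∈ I, c < x → ∀ y ∈ I, y < c → -φ x / ψ x ≤ -φ y / ψ y := by
    intro x hx hcx y hy hyc
    by_contra! h
    refine hno.false_of_nonpos hw.ordConnected (hφ.add hψ (-φ x / ψ x)) hy hx hyc hcx ?_
      (by simp [hφc, hψc]) ?_
    · have := (div_lt_iff_of_neg (hψl y hy hyc)).1 h
      linarith
    · rw [div_mul_cancel₀ _ (hψr x hx hcx).ne']; simp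
  obtain ⟨b, hb, hcb⟩ := exists_mem_gt_of_isOpen hw.isOpen hc
  obtain ⟨a, ha, hac⟩ := exists_mem_lt_of_isOpen hw.isOpen hc
  let S : Set ℝ := (fun x => -φ x / ψ x) '' (I ∩ Ioi c)
  have hSb : BddAbove S := ⟨-φ a / ψ a, by
    rintro _ ⟨x, ⟨hx, hcx⟩, rfl⟩
    exact hle x hx hcx a ha hac⟩
  have hu := hφ.add hψ (sSup S)
  have hucpos : 0 < φ c + sSup S * ψ c := by simp [hφc, hψc]
  refine ⟨_, _, hu, hu.pos_of_nonneg hw hlam (fun x hx => ?_) hc hucpos⟩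
  rcases lt_trichotomy x c with h | h | h
  · have h1 : sSup S ≤ -φ x / ψ x := by
      refine csSup_le ⟨_, b, ⟨hb, hcb⟩, rfl⟩ ?_
      rintro _ ⟨y, ⟨hy, hcy⟩, rfl⟩
      exact hle y hy hcy x hx h
    have := (le_div_iff_of_neg (hψl x hx h)).1 h1
    linarith
  · subst h; exact hucpos.le
  · have h1 : -φ x / ψ x ≤ sSup S := le_csSup hSb ⟨x, ⟨hx, h⟩, rfl⟩
    have := (div_le_iff₀ (hψr x hx h)).1 h1
    linarith

/-! ### The functions `h⁻` and `h⁺` as integrals against Lebesgue measure -/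

/-- The measure `p dx` on `I`. -/
noncomputable def weightedMeasure (I : Set ℝ) (p : ℝ → ℝ) : Measure ℝ :=
  (volume.restrict I).withDensity fun x => ENNReal.ofReal (p x)

theorem setLIntegral_weightedMeasure (hI : MeasurableSet I) (hp : ContinuousOn p I)
    (g : ℝ → ℝ≥0∞) {s : Set ℝ} (hs : MeasurableSet s) :
    ∫⁻ x in s, g x ∂weightedMeasure I p = ∫⁻ x in I ∩ s, ENNReal.ofReal (p x) * g x := by
  rw [weightedMeasure, restrict_withDensity hs, Measure.restrict_restrict hs, inter_comm s I,
    lintegral_withDensity_eq_lintegral_mul_non_measurable₀]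
  · rfl
  · exact ((hp.mono inter_subset_left).aemeasurable (hI.inter hs)).ennreal_ofReal
  · exact ae_of_all _ fun x => ENNReal.ofReal_lt_top

theorem lintegral_weightedMeasure (hI : MeasurableSet I) (hp : ContinuousOn p I)
    (g : ℝ → ℝ≥0∞) : ∫⁻ x, g x ∂weightedMeasure I p = ∫⁻ x in I, ENNReal.ofReal (p x) * g x := by
  simpa using setLIntegral_weightedMeasure hI hp g MeasurableSet.univ

theorem weightedMeasure_lt_top_iff (hI : MeasurableSet I) (hp : ContinuousOn p I)
    (h0 : ∀ x ∈ I, 0 < p x) : weightedMeasure I p I < ∞ ↔ IntegrableOn p I := by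
  rw [weightedMeasure, withDensity_apply _ hI, Measure.restrict_restrict hI, inter_self,
    IntegrableOn, Integrable, and_iff_right (hp.aestronglyMeasurable hI),
    hasFiniteIntegral_iff_ofReal]
  exact (ae_restrict_mem hI).mono fun x hx => (h0 x hx).le

theorem strictMonoOn_of_hasDerivAt_pos (hO : I.OrdConnected) {P P' : ℝ → ℝ}
    (hP : ∀ x ∈ I, HasDerivAt P (P' x) x) (h0 : ∀ x ∈ I, 0 < P' x) : StrictMonoOn P I :=
  strictMonoOn_of_hasDerivWithinAt_pos hO.convex
    (fun x hx => (hP x hx).continuousAt.continuousWithinAt)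
    (fun x hx => (hP x (interior_subset hx)).hasDerivWithinAt)
    fun x hx => h0 x (interior_subset hx)

/-- `f` is positive and continuous on `I`, and `P` is a primitive of `f p` there. -/
structure IsPrimitive (I : Set ℝ) (p f P : ℝ → ℝ) : Prop where
  cont : ContinuousOn f I
  pos : ∀ x ∈ I, 0 < f x
  deriv : ∀ x ∈ I, HasDerivAt P (f x * p x) x

section

variable {f P : ℝ → ℝ}

theorem IsPrimitive.continuousOn (hP : IsPrimitive I p f P) : ContinuousOn P I :=
  fun x hx => (hP.deriv x hx).continuousAt.continuousWithinAt

theorem IsPrimitive.strictMonoOn (hw : Weights I p q) (hP : IsPrimitive I p f P) :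
    StrictMonoOn P I :=
  strictMonoOn_of_hasDerivAt_pos hw.ordConnected hP.deriv
    fun x hx => mul_pos (hP.pos x hx) (hw.posLeft x hx)

theorem exists_isPrimitive (hw : Weights I p q) (hf : ContinuousOn f I) (h0 : ∀ x ∈ I, 0 < f x) :
    ∃ P, IsPrimitive I p f P := by
  obtain ⟨c, hc⟩ := hw.nonempty
  exact ⟨_, hf, h0, fun x hx => hasDerivAt_integral_of_continuousOn hw.isOpen hw.ordConnected
    (hf.mul hw.contLeft) hc hx⟩

theorem IsPrimitive.lintegral_Ioo (hw : Weights I p q) (hP : IsPrimitive I p f P) {x y : ℝ}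
    (hx : x ∈ I) (hy : y ∈ I) (hxy : x ≤ y) :
    ∫⁻ t in Ioo x y, ENNReal.ofReal (f t) ∂weightedMeasure I p = ENNReal.ofReal (P y - P x) := by
  have hsub : Icc x y ⊆ I := hw.ordConnected.out hx hy
  have hc : ContinuousOn (fun t => f t * p t) I := hP.cont.mul hw.contLeft
  rw [setLIntegral_weightedMeasure hw.isOpen.measurableSet hw.contLeft _ measurableSet_Ioo,
    inter_eq_self_of_subset_right (Ioo_subset_Icc_self.trans hsub),
    ← integral_eq_sub_of_hasDerivAt_on hw.ordConnected hP.deriv hc hx hy,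
    intervalIntegral.integral_of_le hxy, integral_Ioc_eq_integral_Ioo,
    ofReal_integral_eq_lintegral_ofReal]
  · refine setLIntegral_congr_fun measurableSet_Ioo fun t ht => ?_
    rw [← ENNReal.ofReal_mul (hw.posLeft t (hsub (Ioo_subset_Icc_self ht))).le, mul_comm]
  · exact ((hc.mono hsub).integrableOn_Icc).mono_set Ioo_subset_Icc_self
  · refine (ae_restrict_mem measurableSet_Ioo).mono fun t ht => ?_
    have := hsub (Ioo_subset_Icc_self ht)
    exact (mul_pos (hP.pos t this) (hw.posLeft t this)).le

theorem IsPrimitive.hMinus_eq (hw : Weights I p q) (hP : IsPrimitive I p f P) {θ z : ℝ}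
    (hθ : θ ∈ I) (hz : z ≤ θ) :
    hMinus (weightedMeasure I p) (weightedMeasure I q) f θ z =
      ∫⁻ x in I ∩ Iio z, ENNReal.ofReal (q x * (P θ - P x)) := by
  rw [hMinus, setLIntegral_weightedMeasure hw.isOpen.measurableSet hw.contRight _ measurableSet_Iio]
  refine setLIntegral_congr_fun (hw.isOpen.measurableSet.inter measurableSet_Iio) fun x hx => ?_
  rw [hP.lintegral_Ioo hw hx.1 hθ (hx.2.le.trans hz), ENNReal.ofReal_mul (hw.posRight x hx.1).le]

theorem IsPrimitive.hPlus_eq (hw : Weights I p q) (hP : IsPrimitive I p f P) {θ z : ℝ}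
    (hθ : θ ∈ I) (hz : θ ≤ z) :
    hPlus (weightedMeasure I p) (weightedMeasure I q) f θ z =
      ∫⁻ x in I ∩ Ioi z, ENNReal.ofReal (-(q x * (P θ - P x))) := by
  rw [hPlus, setLIntegral_weightedMeasure hw.isOpen.measurableSet hw.contRight _ measurableSet_Ioi]
  refine setLIntegral_congr_fun (hw.isOpen.measurableSet.inter measurableSet_Ioi) fun x hx => ?_
  rw [hP.lintegral_Ioo hw hθ hx.1 (hz.trans hx.2.le), ← ENNReal.ofReal_mul (hw.posRight x hx.1).le]
  congr 1; ring

theorem IsPrimitive.continuousOn_integrand (hw : Weights I p q) (hP : IsPrimitive I p f P) (θ : ℝ) :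
    ContinuousOn (fun x => q x * (P θ - P x)) I :=
  hw.contRight.mul (continuousOn_const.sub hP.continuousOn)

theorem IsPrimitive.integrand_nonneg (hw : Weights I p q) (hP : IsPrimitive I p f P) {θ x : ℝ}
    (hθ : θ ∈ I) (hx : x ∈ I) (h : x ≤ θ) : 0 ≤ q x * (P θ - P x) :=
  mul_nonneg (hw.posRight x hx).le (sub_nonneg.2 ((hP.strictMonoOn hw).monotoneOn hx hθ h))

theorem IsPrimitive.integrand_nonpos (hw : Weights I p q) (hP : IsPrimitive I p f P) {θ x : ℝ}
    (hθ : θ ∈ I) (hx : x ∈ I) (h : θ ≤ x) : q x * (P θ - P x) ≤ 0 :=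
  mul_nonpos_of_nonneg_of_nonpos (hw.posRight x hx).le
    (sub_nonpos.2 ((hP.strictMonoOn hw).monotoneOn hθ hx h))

theorem integrableOn_iff_lintegral_ofReal_lt_top {s : Set ℝ} (hs : MeasurableSet s) {g : ℝ → ℝ}
    (hg : ContinuousOn g s) (h0 : ∀ x ∈ s, 0 ≤ g x) :
    IntegrableOn g s ↔ ∫⁻ x in s, ENNReal.ofReal (g x) < ∞ := by
  rw [IntegrableOn, Integrable, and_iff_right (hg.aestronglyMeasurable hs),
    hasFiniteIntegral_iff_ofReal ((ae_restrict_mem hs).mono h0)]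

theorem IsPrimitive.hMinus_lt_top_iff (hw : Weights I p q) (hP : IsPrimitive I p f P) {θ z : ℝ}
    (hθ : θ ∈ I) (hz : z ≤ θ) :
    hMinus (weightedMeasure I p) (weightedMeasure I q) f θ z < ∞ ↔
      IntegrableOn (fun x => q x * (P θ - P x)) (I ∩ Iio z) := by
  rw [hP.hMinus_eq hw hθ hz, integrableOn_iff_lintegral_ofReal_lt_top
    (hw.isOpen.measurableSet.inter measurableSet_Iio)
    ((hP.continuousOn_integrand hw θ).mono inter_subset_left)]
  exact fun x hx => hP.integrand_nonneg hw hθ hx.1 (hx.2.le.trans hz)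

theorem IsPrimitive.hPlus_lt_top_iff (hw : Weights I p q) (hP : IsPrimitive I p f P) {θ z : ℝ}
    (hθ : θ ∈ I) (hz : θ ≤ z) :
    hPlus (weightedMeasure I p) (weightedMeasure I q) f θ z < ∞ ↔
      IntegrableOn (fun x => q x * (P θ - P x)) (I ∩ Ioi z) := by
  rw [hP.hPlus_eq hw hθ hz, ← integrableOn_iff_lintegral_ofReal_lt_top
    (g := fun x => -(q x * (P θ - P x))) (hw.isOpen.measurableSet.inter measurableSet_Ioi)
    ((hP.continuousOn_integrand hw θ).neg.mono inter_subset_left)]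
  · exact integrable_neg_iff (f := fun x => q x * (P θ - P x))
  · exact fun x hx => neg_nonneg.2 (hP.integrand_nonpos hw hθ hx.1 (hz.trans hx.2.le))

theorem IsPrimitive.hMinus_eq_ofReal (hw : Weights I p q) (hP : IsPrimitive I p f P) {θ z : ℝ}
    (hθ : θ ∈ I) (hz : z ≤ θ) (hi : IntegrableOn (fun x => q x * (P θ - P x)) (I ∩ Iio z)) :
    hMinus (weightedMeasure I p) (weightedMeasure I q) f θ z =
      ENNReal.ofReal (∫ x in I ∩ Iio z, q x * (P θ - P x)) := by
  rw [hP.hMinus_eq hw hθ hz, ofReal_integral_eq_lintegral_ofReal hi]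
  exact (ae_restrict_mem (hw.isOpen.measurableSet.inter measurableSet_Iio)).mono
    fun x hx => hP.integrand_nonneg hw hθ hx.1 (hx.2.le.trans hz)

theorem IsPrimitive.hPlus_eq_ofReal (hw : Weights I p q) (hP : IsPrimitive I p f P) {θ z : ℝ}
    (hθ : θ ∈ I) (hz : θ ≤ z) (hi : IntegrableOn (fun x => q x * (P θ - P x)) (I ∩ Ioi z)) :
    hPlus (weightedMeasure I p) (weightedMeasure I q) f θ z =
      ENNReal.ofReal (-∫ x in I ∩ Ioi z, q x * (P θ - P x)) := by
  rw [hP.hPlus_eq hw hθ hz, ← integral_neg,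
    ofReal_integral_eq_lintegral_ofReal (f := fun x => -(q x * (P θ - P x))) hi.neg]
  exact (ae_restrict_mem (hw.isOpen.measurableSet.inter measurableSet_Ioi)).mono
    fun x hx => neg_nonneg.2 (hP.integrand_nonpos hw hθ hx.1 (hz.trans hx.2.le))

theorem inter_Ioi_ae_eq (I : Set ℝ) (z : ℝ) :
    (I ∩ Ioi z : Set ℝ) =ᵐ[volume] (I ∩ Ici z : Set ℝ) :=
  (ae_eq_refl I).inter Ioi_ae_eq_Ici

theorem integrableOn_iff_inter_Iio_inter_Ioi {g : ℝ → ℝ} (I : Set ℝ) (z : ℝ) :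
    IntegrableOn g I ↔ IntegrableOn g (I ∩ Iio z) ∧ IntegrableOn g (I ∩ Ioi z) := by
  rw [integrableOn_congr_set_ae (inter_Ioi_ae_eq I z), ← integrableOn_union,
    ← inter_union_distrib_left, Iio_union_Ici, inter_univ]

theorem setIntegral_Iio_add_Ioi (hI : MeasurableSet I) {g : ℝ → ℝ} (hg : IntegrableOn g I) (z : ℝ) :
    ∫ x in I ∩ Iio z, g x = (∫ x in I, g x) - ∫ x in I ∩ Ioi z, g x := by
  rw [setIntegral_congr_set (inter_Ioi_ae_eq I z), eq_sub_iff_add_eq,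
    ← setIntegral_union _ (hI.inter measurableSet_Ici) (hg.mono_set inter_subset_left)
      (hg.mono_set inter_subset_left), ← inter_union_distrib_left, Iio_union_Ici, inter_univ]
  exact (Iio_disjoint_Ici le_rfl).mono inter_subset_right inter_subset_right

/-! ### The matching point -/

theorem integrableOn_mul_sub_iff (hq : IntegrableOn q I) (a : ℝ) :
    IntegrableOn (fun x => q x * (a - P x)) I ↔ IntegrableOn (fun x => q x * P x) I := by
  have h1 : IntegrableOn (fun x => a * q x) I := Integrable.const_mul hq a
  constructor <;> intro h
  · exact (h1.sub h).congr_fun_ae (ae_of_all _ fun x => by simp; ring)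
  · exact (h1.sub h).congr_fun_ae (ae_of_all _ fun x => by simp; ring)

theorem IsPrimitive.hFinite_iff (hw : Weights I p q) (hP : IsPrimitive I p f P)
    (hq : IntegrableOn q I) {s : ℝ} (hs : s ∈ I) :
    (hMinus (weightedMeasure I p) (weightedMeasure I q) f s s < ∞ ∧
      hPlus (weightedMeasure I p) (weightedMeasure I q) f s s < ∞) ↔
      IntegrableOn (fun x => q x * P x) I := by
  rw [hP.hMinus_lt_top_iff hw hs le_rfl, hP.hPlus_lt_top_iff hw hs le_rfl,
    ← integrableOn_iff_inter_Iio_inter_Ioi, integrableOn_mul_sub_iff hq]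

/-- `θ` is a matching point precisely when `P θ` is the average of `P` with respect to `q dx`. -/
theorem IsPrimitive.matching_iff (hw : Weights I p q) (hP : IsPrimitive I p f P)
    (hq : IntegrableOn q I) {θ : ℝ} (hθ : θ ∈ I) :
    (hMinus (weightedMeasure I p) (weightedMeasure I q) f θ θ =
      hPlus (weightedMeasure I p) (weightedMeasure I q) f θ θ ∧
      hMinus (weightedMeasure I p) (weightedMeasure I q) f θ θ < ∞) ↔
    IntegrableOn (fun x => q x * P x) I ∧ ∫ x in I, q x * (P θ - P x) = 0 := by
  have hI := hw.isOpen.measurableSet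
  have key : IntegrableOn (fun x => q x * P x) I →
      (hMinus (weightedMeasure I p) (weightedMeasure I q) f θ θ =
        hPlus (weightedMeasure I p) (weightedMeasure I q) f θ θ ↔
        ∫ x in I, q x * (P θ - P x) = 0) := fun hi => by
    rw [← integrableOn_mul_sub_iff hq (P θ)] at hi
    have hs := setIntegral_Iio_add_Ioi hI hi θ
    rw [hP.hMinus_eq_ofReal hw hθ le_rfl (hi.mono_set inter_subset_left),
      hP.hPlus_eq_ofReal hw hθ le_rfl (hi.mono_set inter_subset_left),
      ENNReal.ofReal_eq_ofReal_iff]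
    · constructor <;> intro h <;> linarith
    · exact setIntegral_nonneg (hI.inter measurableSet_Iio)
        fun x hx => hP.integrand_nonneg hw hθ hx.1 hx.2.le
    · exact neg_nonneg.2 (setIntegral_nonpos (hI.inter measurableSet_Ioi)
        fun x hx => hP.integrand_nonpos hw hθ hx.1 hx.2.le)
  constructor
  · rintro ⟨h1, h2⟩
    have hi := (hP.hFinite_iff hw hq hθ).1 ⟨h2, h1 ▸ h2⟩
    exact ⟨hi, (key hi).1 h1⟩
  · rintro ⟨hi, h⟩
    exact ⟨(key hi).2 h, ((hP.hFinite_iff hw hq hθ).2 hi).1⟩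

theorem setIntegral_pos_of_isOpen (hI : IsOpen I) (hne : I.Nonempty) {g : ℝ → ℝ}
    (hg : IntegrableOn g I) (h0 : ∀ x ∈ I, 0 < g x) : 0 < ∫ x in I, g x := by
  rw [setIntegral_pos_iff_support_of_nonneg_ae
    ((ae_restrict_mem hI.measurableSet).mono fun x hx => (h0 x hx).le) hg]
  have h : Function.support g ∩ I = I := inter_eq_right.2 fun x hx => (h0 x hx).ne'
  rw [h]
  exact hI.measure_pos volume hne

theorem integral_mul_sub (hq : IntegrableOn q I) (hi : IntegrableOn (fun x => q x * P x) I)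
    (a : ℝ) : ∫ x in I, q x * (a - P x) = a * (∫ x in I, q x) - ∫ x in I, q x * P x := by
  rw [← integral_const_mul, ← integral_sub (hq.const_mul _) hi]
  congr 1; funext x; ring

/-- The matching point exists because the `q dx`-average of the continuous function `P` is one of
its values, and is unique because `P` is strictly increasing. -/
theorem IsPrimitive.existsUnique_matching (hw : Weights I p q) (hP : IsPrimitive I p f P)
    (hq : IntegrableOn q I) (hi : IntegrableOn (fun x => q x * P x) I) :
    ∃! θ, θ ∈ I ∧ ∫ x in I, q x * (P θ - P x) = 0 := by
  have hQ := setIntegral_pos_of_isOpen hw.isOpen hw.nonempty hq hw.posRight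
  -- At the average value `a` of `P` the integral of `q (a - P)` vanishes.
  have h0 := integral_mul_sub hq hi ((∫ t in I, q t * P t) / ∫ t in I, q t)
  rw [div_mul_cancel₀ _ hQ.ne', sub_self] at h0
  have hint := (integrableOn_mul_sub_iff hq ((∫ t in I, q t * P t) / ∫ t in I, q t)).2 hi
  have hle : ∃ x ∈ I, P x ≤ (∫ t in I, q t * P t) / ∫ t in I, q t := by
    by_contra! h
    have := setIntegral_pos_of_isOpen hw.isOpen hw.nonempty hint.neg fun x hx => by
      simpa using mul_neg_of_pos_of_neg (hw.posRight x hx) (sub_neg.2 (h x hx))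
    simp only [Pi.neg_apply, integral_neg, h0, neg_zero, lt_irrefl] at this
  have hge : ∃ x ∈ I, (∫ t in I, q t * P t) / ∫ t in I, q t ≤ P x := by
    by_contra! h
    exact (setIntegral_pos_of_isOpen hw.isOpen hw.nonempty hint fun x hx =>
      mul_pos (hw.posRight x hx) (sub_pos.2 (h x hx))).ne' h0
  obtain ⟨x, hx, hx'⟩ := hle
  obtain ⟨y, hy, hy'⟩ := hge
  obtain ⟨θ, hθ, hθ'⟩ := hw.ordConnected.isPreconnected.intermediate_value hx hy hP.continuousOn
    ⟨hx', hy'⟩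
  have hval : ∀ θ, ∫ x in I, q x * (P θ - P x) = 0 ↔
      P θ = (∫ t in I, q t * P t) / ∫ t in I, q t := fun θ => by
    rw [integral_mul_sub hq hi, sub_eq_zero, eq_div_iff hQ.ne']
  refine ⟨θ, ⟨hθ, (hval θ).2 hθ'⟩, fun η ⟨hη, hη'⟩ => ?_⟩
  exact (hP.strictMonoOn hw).injOn hη hθ (((hval η).1 hη').trans hθ'.symm)

end

/-! ### The solution of the Dirichlet problem with right-hand side `f` -/

/-- `θ` is the matching point of `f`, expressed by a primitive `P` of `f p`. -/
structure IsMatched (I : Set ℝ) (p q f P : ℝ → ℝ) (θ : ℝ) : Prop where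
  weights : Weights I p q
  prim : IsPrimitive I p f P
  finite : IntegrableOn q I
  integrable : IntegrableOn (fun x => q x * P x) I
  mem : θ ∈ I
  integral_eq_zero : ∫ x in I, q x * (P θ - P x) = 0

/-- The common value of `h⁻` and `h⁺`: at the matching point `θ` the total integral of
`q (P θ - P)` vanishes, so that `h z = ∫_{-M}^z q (P θ - P) = ∫_z^N q (P - P θ)`. It solves
`(h' / q)' = - f p` with zero boundary values. -/
noncomputable def matchFun (I : Set ℝ) (q P : ℝ → ℝ) (θ z : ℝ) : ℝ :=
  ∫ x in I ∩ Iio z, q x * (P θ - P x)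

section

variable {f P : ℝ → ℝ} {θ : ℝ}

theorem IsMatched.integrable_integrand (h : IsMatched I p q f P θ) :
    IntegrableOn (fun x => q x * (P θ - P x)) I :=
  (integrableOn_mul_sub_iff h.finite (P θ)).2 h.integrable

theorem IsMatched.matchFun_eq_neg (h : IsMatched I p q f P θ) (z : ℝ) :
    matchFun I q P θ z = -∫ x in I ∩ Ioi z, q x * (P θ - P x) := by
  rw [matchFun, setIntegral_Iio_add_Ioi h.weights.isOpen.measurableSet h.integrable_integrand z,
    h.integral_eq_zero, zero_sub]

theorem IsMatched.hMinus_eq (h : IsMatched I p q f P θ) {z : ℝ} (hz : z ≤ θ) :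
    hMinus (weightedMeasure I p) (weightedMeasure I q) f θ z =
      ENNReal.ofReal (matchFun I q P θ z) :=
  h.prim.hMinus_eq_ofReal h.weights h.mem hz (h.integrable_integrand.mono_set inter_subset_left)

theorem IsMatched.hPlus_eq (h : IsMatched I p q f P θ) {z : ℝ} (hz : θ ≤ z) :
    hPlus (weightedMeasure I p) (weightedMeasure I q) f θ z =
      ENNReal.ofReal (matchFun I q P θ z) := by
  rw [h.matchFun_eq_neg]
  exact h.prim.hPlus_eq_ofReal h.weights h.mem hz
    (h.integrable_integrand.mono_set inter_subset_left)

theorem setIntegral_Iio_sub (hO : I.OrdConnected) {g : ℝ → ℝ}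
    (hg : IntegrableOn g I) {x y : ℝ} (hx : x ∈ I) (hy : y ∈ I) :
    ∫ t in I ∩ Iio y, g t = (∫ t in I ∩ Iio x, g t) + ∫ t in x..y, g t := by
  wlog hxy : x ≤ y generalizing x y
  · rw [this hy hx (le_of_not_ge hxy), intervalIntegral.integral_symm]; ring
  have hsub : Ico x y ⊆ I := Ico_subset_Icc_self.trans (hO.out hx hy)
  have h : I ∩ Iio y = (I ∩ Iio x) ∪ Ico x y := by
    rw [← Iio_union_Ico_eq_Iio hxy, inter_union_distrib_left, inter_eq_self_of_subset_right hsub]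
  rw [h, setIntegral_union _ measurableSet_Ico (hg.mono_set inter_subset_left) (hg.mono_set hsub),
    intervalIntegral.integral_of_le hxy, integral_Ico_eq_integral_Ioo,
    integral_Ioc_eq_integral_Ioo]
  exact disjoint_left.2 fun t ht ht' => ht.2.not_ge ht'.1

theorem hasDerivAt_setIntegral_Iio (hI : IsOpen I) (hO : I.OrdConnected) {g : ℝ → ℝ}
    (hg : IntegrableOn g I) (hc : ContinuousOn g I) {x : ℝ} (hx : x ∈ I) :
    HasDerivAt (fun z => ∫ t in I ∩ Iio z, g t) (g x) x := by
  refine HasDerivAt.congr_of_eventuallyEq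
    ((hasDerivAt_integral_of_continuousOn hI hO hc hx hx).const_add (∫ t in I ∩ Iio x, g t)) ?_
  filter_upwards [hI.mem_nhds hx] with z hz
  exact setIntegral_Iio_sub hO hg hx hz

theorem IsMatched.hasDerivAt (h : IsMatched I p q f P θ) {z : ℝ} (hz : z ∈ I) :
    HasDerivAt (matchFun I q P θ) (q z * (P θ - P z)) z :=
  hasDerivAt_setIntegral_Iio h.weights.isOpen h.weights.ordConnected h.integrable_integrand
    (h.prim.continuousOn_integrand h.weights θ) hz

theorem IsMatched.continuousOn (h : IsMatched I p q f P θ) : ContinuousOn (matchFun I q P θ) I :=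
  fun _ hz => (h.hasDerivAt hz).continuousAt.continuousWithinAt

theorem IsMatched.pos (h : IsMatched I p q f P θ) {z : ℝ} (hz : z ∈ I) :
    0 < matchFun I q P θ z := by
  have hm := h.prim.strictMonoOn h.weights
  rcases le_total z θ with hzθ | hzθ
  · refine setIntegral_pos_of_isOpen (h.weights.isOpen.inter isOpen_Iio)
      (exists_mem_lt_of_isOpen h.weights.isOpen hz)
      (h.integrable_integrand.mono_set inter_subset_left) fun x hx => ?_
    exact mul_pos (h.weights.posRight x hx.1) (sub_pos.2 (hm hx.1 h.mem (hx.2.trans_le hzθ)))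
  · rw [h.matchFun_eq_neg, ← integral_neg]
    refine setIntegral_pos_of_isOpen (h.weights.isOpen.inter isOpen_Ioi)
      (exists_mem_gt_of_isOpen h.weights.isOpen hz)
      (h.integrable_integrand.mono_set inter_subset_left).neg fun x hx => ?_
    exact neg_pos.2 (mul_neg_of_pos_of_neg (h.weights.posRight x hx.1)
      (sub_neg.2 (hm h.mem hx.1 (hzθ.trans_lt hx.2))))

theorem tendsto_setIntegral_Iio_left (hI : MeasurableSet I) {g : ℝ → ℝ} (hg : IntegrableOn g I)
    {α : ℕ → ℝ} (hα : Antitone α) (hlt : ∀ x ∈ I, ∃ n, α n < x) :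
    Tendsto (fun n => ∫ t in I ∩ Iio (α n), g t) atTop (𝓝 0) := by
  have h := tendsto_setIntegral_of_antitone (μ := volume) (f := g) (s := fun n => I ∩ Iio (α n))
    (fun n => hI.inter measurableSet_Iio)
    (fun m n hmn => inter_subset_inter_right I (Iio_subset_Iio (hα hmn)))
    ⟨0, hg.mono_set inter_subset_left⟩
  have h0 : ⋂ n, I ∩ Iio (α n) = ∅ := by
    rw [eq_empty_iff_forall_notMem]
    intro x hx
    rw [mem_iInter] at hx
    obtain ⟨n, hn⟩ := hlt x (hx 0).1
    exact (hx n).2.not_gt hn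
  simpa [h0] using h

theorem tendsto_setIntegral_Iio_right (hI : MeasurableSet I) {g : ℝ → ℝ} (hg : IntegrableOn g I)
    {β : ℕ → ℝ} (hβ : Monotone β) (hlt : ∀ x ∈ I, ∃ n, x < β n) :
    Tendsto (fun n => ∫ t in I ∩ Iio (β n), g t) atTop (𝓝 (∫ t in I, g t)) := by
  have h0 : ⋃ n, I ∩ Iio (β n) = I := by
    rw [← inter_iUnion]
    exact inter_eq_left.2 fun x hx => mem_iUnion.2 (hlt x hx)
  have h := tendsto_setIntegral_of_monotone (μ := volume) (f := g) (s := fun n => I ∩ Iio (β n))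
    (fun n => hI.inter measurableSet_Iio)
    (fun m n hmn => inter_subset_inter_right I (Iio_subset_Iio (hβ hmn)))
    (by rwa [h0])
  rwa [h0] at h

/-- The variational value at the matching point is the largest `lam` with `lam h ≤ f`. -/
theorem IsMatched.ofReal_le_variationalValue_iff {M N : EReal} (h : IsMatched (E M N) p q f P θ)
    (lam : ℝ) :
    ENNReal.ofReal lam ≤ variationalValue M N (weightedMeasure (E M N) p)
      (weightedMeasure (E M N) q) f θ ↔ ∀ z ∈ E M N, lam * matchFun (E M N) q P θ z ≤ f z := by
  have hone : ∀ z ∈ E M N, (ENNReal.ofReal lam ≤ (ENNReal.ofReal (matchFun (E M N) q P θ z) /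
      ENNReal.ofReal (f z))⁻¹ ↔ lam * matchFun (E M N) q P θ z ≤ f z) := fun z hz => by
    rw [← ENNReal.ofReal_div_of_pos (h.prim.pos z hz),
      ← ENNReal.ofReal_inv_of_pos (div_pos (h.pos hz) (h.prim.pos z hz)), inv_div,
      ENNReal.ofReal_le_ofReal_iff (div_pos (h.prim.pos z hz) (h.pos hz)).le,
      le_div_iff₀ (h.pos hz)]
  rw [variationalValue, le_min_iff, le_iInf₂_iff, le_iInf₂_iff]
  constructor
  · rintro ⟨hl, hr⟩ z hz
    have hne : ∀ z ∈ E M N, z ≠ θ → lam * matchFun (E M N) q P θ z ≤ f z := fun z hz hzθ => by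
      rcases lt_or_gt_of_ne hzθ with hlt | hlt
      · rw [← hone z hz, ← h.hMinus_eq hlt.le]
        exact hl z ⟨hz, hlt⟩
      · rw [← hone z hz, ← h.hPlus_eq hlt.le]
        exact hr z ⟨hz, hlt⟩
    rcases eq_or_ne z θ with rfl | hzθ
    · have hnhds : E M N ∈ 𝓝[≠] z :=
        mem_nhdsWithin_of_mem_nhds (h.weights.isOpen.mem_nhds hz)
      have hIz := h.weights.isOpen.mem_nhds hz
      refine le_of_tendsto_of_tendsto
        ((continuousAt_const.mul (h.continuousOn.continuousAt hIz)).mono_left nhdsWithin_le_nhds)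
        ((h.prim.cont.continuousAt hIz).mono_left (nhdsWithin_le_nhds (s := {z}ᶜ))) ?_
      filter_upwards [hnhds, self_mem_nhdsWithin] with x hx hxz using hne x hx hxz
    · exact hne z hz hzθ
  · intro hall
    refine ⟨fun z hz => ?_, fun z hz => ?_⟩
    · rw [IIMinus, h.hMinus_eq (le_of_lt hz.2), hone z hz.1]
      exact hall z hz.1
    · rw [IIPlus, h.hPlus_eq (le_of_lt hz.2), hone z hz.1]
      exact hall z hz.1

/-! ### A positive solution is a test function for the variational formula -/

/-- For a positive solution `u` of `(u' / q)' = - lam p u`, integration of `u' = q v` over compact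
intervals bounds `∫ q |v - v c|`, so that `u` is admissible. -/
theorem IsSolution.integrableOn (hw : Weights I p q) (hq : IntegrableOn q I) {lam : ℝ}
    (hlam : 0 ≤ lam) {u v : ℝ → ℝ} (hu : IsSolution I p q lam u v) (hpos : ∀ x ∈ I, 0 < u x) :
    IntegrableOn (fun x => q x * v x) I := by
  obtain ⟨c, hc⟩ := hw.nonempty
  obtain ⟨α, β, hα, hβ, hαI, hβI, hαc, hcβ, hex⟩ := exists_exhaustion hw.isOpen hc
  have hvanti : AntitoneOn v I := by
    refine antitoneOn_of_hasDerivWithinAt_nonpos hw.ordConnected.convex hu.continuousOn.2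
      (fun x hx => (hu x (interior_subset hx)).2.hasDerivWithinAt) fun x hx => ?_
    have hx := interior_subset hx
    have := mul_nonneg (mul_nonneg hlam (hw.posLeft x hx).le) (hpos x hx).le
    linarith
  have hcont : ContinuousOn (fun x => q x * v x) I := hw.contRight.mul hu.continuousOn.2
  have hcont' : ContinuousOn (fun x => q x * (v x - v c)) I :=
    hw.contRight.mul (hu.continuousOn.2.sub continuousOn_const)
  have hint : ∀ x ∈ I, ∀ y ∈ I, x ≤ y →
      |(∫ t in x..y, q t * (v t - v c)) - (u y - u x)| ≤ |v c| * ∫ t in I, q t := by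
    intro x hx y hy hxy
    have h1 : ∫ t in x..y, q t * (v t - v c) = (u y - u x) - v c * ∫ t in x..y, q t := by
      rw [← integral_eq_sub_of_hasDerivAt_on hw.ordConnected (fun t ht => (hu t ht).1) hcont hx hy,
        ← intervalIntegral.integral_const_mul, ← intervalIntegral.integral_sub
        (intervalIntegrable_of_continuousOn hw.ordConnected hcont hx hy)
        ((intervalIntegrable_of_continuousOn hw.ordConnected hw.contRight hx hy).const_mul _)]
      congr 1; funext t; ring
    rw [h1, sub_sub_cancel_left, abs_neg, abs_mul]
    have h2 : ∫ t in x..y, q t ≤ ∫ t in I, q t := by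
      rw [intervalIntegral.integral_of_le hxy]
      refine setIntegral_mono_set hq
        ((ae_restrict_mem hw.isOpen.measurableSet).mono fun t ht => (hw.posRight t ht).le) ?_
      exact (Ioc_subset_Icc_self.trans (hw.ordConnected.out hx hy)).eventuallyLE
    have h3 : 0 ≤ ∫ t in x..y, q t := intervalIntegral.integral_nonneg hxy fun t ht =>
      (hw.posRight t (hw.ordConnected.out hx hy ht)).le
    rw [abs_of_nonneg h3]
    gcongr
  have hcover : AECover (volume.restrict I) atTop fun n => Ioc (α n) (β n) :=
    { ae_eventually_mem := (ae_restrict_mem hw.isOpen.measurableSet).mono fun x hx => by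
        obtain ⟨n, hn, hn'⟩ := hex x hx
        filter_upwards [eventually_ge_atTop n] with m hm
        exact ⟨(hα hm).trans_lt hn, (hn'.trans_le (hβ hm)).le⟩
      measurableSet := fun _ => measurableSet_Ioc }
  have hres : ∀ n, (volume.restrict I).restrict (Ioc (α n) (β n)) =
      volume.restrict (Ioc (α n) (β n)) := fun n => by
    rw [Measure.restrict_restrict measurableSet_Ioc, inter_eq_self_of_subset_left
      (Ioc_subset_Icc_self.trans (hw.ordConnected.out (hαI n) (hβI n)))]
  have hmain : IntegrableOn (fun x => q x * (v x - v c)) I := by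
    refine hcover.integrable_of_integral_norm_bounded
      (2 * u c + 2 * (|v c| * ∫ t in I, q t)) (fun n => ?_) (Eventually.of_forall fun n => ?_)
    · rw [IntegrableOn, hres]
      exact (intervalIntegrable_iff_integrableOn_Ioc_of_le ((hαc n).trans (hcβ n))).1
        (intervalIntegrable_of_continuousOn hw.ordConnected hcont' (hαI n) (hβI n))
    · have hcn := hcont'.norm
      rw [hres, ← intervalIntegral.integral_of_le ((hαc n).trans (hcβ n)),
        ← intervalIntegral.integral_add_adjacent_intervals
        (intervalIntegrable_of_continuousOn hw.ordConnected hcn (hαI n) hc)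
        (intervalIntegrable_of_continuousOn hw.ordConnected hcn hc (hβI n))]
      have e1 : ∫ t in (α n)..c, ‖q t * (v t - v c)‖ = ∫ t in (α n)..c, q t * (v t - v c) := by
        refine intervalIntegral.integral_congr fun t ht => ?_
        rw [uIcc_of_le (hαc n)] at ht
        have htI := hw.ordConnected.out (hαI n) hc ht
        exact Real.norm_of_nonneg (mul_nonneg (hw.posRight t htI).le
          (sub_nonneg.2 (hvanti htI hc ht.2)))
      have e2 : ∫ t in c..(β n), ‖q t * (v t - v c)‖ = -∫ t in c..(β n), q t * (v t - v c) := by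
        rw [← intervalIntegral.integral_neg]
        refine intervalIntegral.integral_congr fun t ht => ?_
        rw [uIcc_of_le (hcβ n)] at ht
        have htI := hw.ordConnected.out hc (hβI n) ht
        exact Real.norm_of_nonpos (mul_nonpos_of_nonneg_of_nonpos (hw.posRight t htI).le
          (sub_nonpos.2 (hvanti hc htI ht.1)))
      have b1 := (abs_le.1 (hint _ (hαI n) c hc (hαc n))).2
      have b2 := (abs_le.1 (hint c hc _ (hβI n) (hcβ n))).1
      have := hpos _ (hαI n)
      have := hpos _ (hβI n)
      rw [e1, e2]
      linarith
  have := hmain.add (hq.const_mul (v c))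
  exact this.congr_fun_ae (ae_of_all _ fun x => by simp; ring)

/-- If `u` is a positive solution of `(u' / q)' = - lam p u`, then the Dirichlet solution `h` with
right-hand side `u` satisfies `lam h ≤ u`: the difference `lam h - u` is a monotone function of the
scale `∫ q`, hence bounded above by its limit at one of the end points, where `h` vanishes. -/
theorem IsMatched.mul_matchFun_le {lam : ℝ} (hlam : 0 < lam) {u v : ℝ → ℝ}
    (hu : IsSolution I p q lam u v) (h : IsMatched I p q u (fun x => -v x / lam) θ) {z : ℝ}
    (hz : z ∈ I) : lam * matchFun I q (fun x => -v x / lam) θ z ≤ u z := by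
  have hw := h.weights
  obtain ⟨α, β, hα, hβ, hαI, hβI, -, -, hex⟩ := exists_exhaustion hw.isOpen hz
  have hd : ∀ x ∈ I, HasDerivAt (fun y => lam * matchFun I q (fun x => -v x / lam) θ y - u y)
      (-(q x * v θ)) x := fun x hx =>
    (((h.hasDerivAt hx).const_mul lam).sub (hu x hx).1).congr_deriv (by field_simp; ring)
  have hc : ContinuousOn (fun y => lam * matchFun I q (fun x => -v x / lam) θ y - u y) I :=
    fun x hx => (hd x hx).continuousAt.continuousWithinAt
  rcases le_total 0 (v θ) with hv | hv
  · have hanti := antitoneOn_of_hasDerivWithinAt_nonpos hw.ordConnected.convex hc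
      (fun x hx => (hd x (interior_subset hx)).hasDerivWithinAt) fun x hx =>
        neg_nonpos.2 (mul_nonneg (hw.posRight x (interior_subset hx)).le hv)
    have hlim := (tendsto_setIntegral_Iio_left hw.isOpen.measurableSet h.integrable_integrand hα
      fun x hx => (hex x hx).imp fun _ => And.left).const_mul lam
    rw [mul_zero] at hlim
    rw [← sub_nonpos]
    refine ge_of_tendsto hlim ?_
    obtain ⟨n, hn, -⟩ := hex z hz
    filter_upwards [eventually_ge_atTop n] with m hm
    have h1 := hanti (hαI m) hz ((hα hm).trans hn.le)
    have h2 := h.prim.pos _ (hαI m)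
    exact h1.trans (sub_le_self _ h2.le)
  · have hmono := monotoneOn_of_hasDerivWithinAt_nonneg hw.ordConnected.convex hc
      (fun x hx => (hd x (interior_subset hx)).hasDerivWithinAt) fun x hx =>
        neg_nonneg.2 (mul_nonpos_of_nonneg_of_nonpos (hw.posRight x (interior_subset hx)).le hv)
    have hlim := (tendsto_setIntegral_Iio_right hw.isOpen.measurableSet h.integrable_integrand hβ
      fun x hx => (hex x hx).imp fun _ => And.right).const_mul lam
    rw [h.integral_eq_zero, mul_zero] at hlim
    rw [← sub_nonpos]
    refine ge_of_tendsto hlim ?_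
    obtain ⟨n, -, hn⟩ := hex z hz
    filter_upwards [eventually_ge_atTop n] with m hm
    have h1 := hmono hz (hβI m) (hn.le.trans (hβ hm))
    have h2 := h.prim.pos _ (hβI m)
    exact h1.trans (sub_le_self _ h2.le)

/-- The variational formula reaches every `lam` for which the eigenvalue equation does not
oscillate. -/
theorem NonOscillating.exists_le_matchFun (hw : Weights I p q) (hq : IntegrableOn q I) {lam : ℝ}
    (hlam : 0 < lam) (hno : NonOscillating I p q lam) :
    ∃ f P : ℝ → ℝ, ∃ θ, IsMatched I p q f P θ ∧ ∀ z ∈ I, lam * matchFun I q P θ z ≤ f z := by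
  obtain ⟨u, v, hu, hpos⟩ := hno.exists_pos_solution hw hlam.le
  have hP : IsPrimitive I p u (fun x => -v x / lam) :=
    ⟨hu.continuousOn.1, hpos, fun x hx =>
      ((hu x hx).2.neg.div_const lam).congr_deriv (by field_simp)⟩
  have hi : IntegrableOn (fun x => q x * (-v x / lam)) I :=
    Integrable.congr ((hu.integrableOn hw hq hlam.le hpos).neg.div_const lam)
      (ae_of_all _ fun x => by simp; ring)
  obtain ⟨θ, ⟨hθ, h0⟩, -⟩ := hP.existsUnique_matching hw hq hi
  have hm : IsMatched I p q u (fun x => -v x / lam) θ := ⟨hw, hP, hq, hi, hθ, h0⟩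
  exact ⟨u, _, θ, hm, fun z hz => hm.mul_matchFun_le hlam hu hz⟩

/-! ### Absolutely continuous functions -/

theorem exists_lipschitzOnWith_of_hasDerivAt (hO : I.OrdConnected) {w w' : ℝ → ℝ}
    (hw : ∀ x ∈ I, HasDerivAt w (w' x) x) (hw' : ContinuousOn w' I) {x y : ℝ} (hx : x ∈ I)
    (hy : y ∈ I) : ∃ K, LipschitzOnWith K w (uIcc x y) := by
  have hsub := hO.uIcc_subset hx hy
  obtain ⟨K, hK⟩ := isCompact_uIcc.exists_bound_of_continuousOn (hw'.mono hsub)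
  refine ⟨K.toNNReal, (convex_uIcc x y).lipschitzOnWith_of_nnnorm_hasDerivWithin_le
    (fun t ht => (hw t (hsub ht)).hasDerivWithinAt) fun t ht => ?_⟩
  rw [← norm_toNNReal]
  exact Real.toNNReal_le_toNNReal (hK t ht)

theorem absolutelyContinuousOnInterval_of_hasDerivAt (hO : I.OrdConnected) {w w' : ℝ → ℝ}
    (hw : ∀ x ∈ I, HasDerivAt w (w' x) x) (hw' : ContinuousOn w' I) {x y : ℝ} (hx : x ∈ I)
    (hy : y ∈ I) : AbsolutelyContinuousOnInterval w x y :=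
  (exists_lipschitzOnWith_of_hasDerivAt hO hw hw' hx hy).choose_spec.absolutelyContinuousOnInterval

theorem absolutelyContinuousOnInterval_comp {φ w : ℝ → ℝ} (hφ : LipschitzWith 1 φ) {x y : ℝ}
    (hw : AbsolutelyContinuousOnInterval w x y) :
    AbsolutelyContinuousOnInterval (fun t => φ (w t)) x y := by
  rw [absolutelyContinuousOnInterval_iff] at hw ⊢
  intro ε hε
  obtain ⟨δ, hδ, h⟩ := hw ε hε
  refine ⟨δ, hδ, fun J hJ hJδ => (Finset.sum_le_sum fun i _ => ?_).trans_lt (h J hJ hJδ)⟩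
  simpa using hφ.dist_le_mul (w (J.2 i).1) (w (J.2 i).2)

theorem abs_deriv_comp_le {φ w : ℝ → ℝ} (hφ : LipschitzWith 1 φ) {d d' x : ℝ}
    (hw : HasDerivAt w d x) (hφw : HasDerivAt (fun t => φ (w t)) d' x) : |d'| ≤ |d| := by
  refine le_of_tendsto_of_tendsto (hasDerivAt_iff_tendsto_slope.1 hφw).abs
    (hasDerivAt_iff_tendsto_slope.1 hw).abs (Eventually.of_forall fun y => ?_)
  simp only [slope_def_field, abs_div]
  have := hφ.dist_le_mul (w y) (w x)
  simp only [Real.dist_eq, NNReal.coe_one, one_mul] at this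
  gcongr

/-! ### The Riccati inequality and lower bounds for the energy -/

theorem IsMatched.hasDerivAt_riccati (h : IsMatched I p q f P θ) {x : ℝ} (hx : x ∈ I) :
    HasDerivAt (fun x => (P θ - P x) / matchFun I q P θ x)
      (-(f x * p x) / matchFun I q P θ x -
        q x * ((P θ - P x) / matchFun I q P θ x) ^ 2) x := by
  have hh := (h.pos hx).ne'
  refine (((h.prim.deriv x hx).const_sub (P θ)).div (h.hasDerivAt hx) hh).congr_deriv ?_
  field_simp

/-- Barta's estimate on a compact interval. The function `ψ = h' / (q h)` satisfies
`ψ' ≤ - lam p - q ψ²`, whence `(g² ψ)' ≤ g'² / q - lam p g²` for every `g`. -/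
theorem IsMatched.barta (h : IsMatched I p q f P θ) {lam : ℝ}
    (hle : ∀ z ∈ I, lam * matchFun I q P θ z ≤ f z) {g : ℝ → ℝ} {α β : ℝ} (hα : α ∈ I) (hβ : β ∈ I)
    (hαβ : α ≤ β) (hg : AbsolutelyContinuousOnInterval g α β)
    (hi : IntervalIntegrable (fun x => deriv g x ^ 2 / q x) volume α β) :
    lam * (∫ x in α..β, p x * g x ^ 2) + (g β ^ 2 * ((P θ - P β) / matchFun I q P θ β) -
      g α ^ 2 * ((P θ - P α) / matchFun I q P θ α)) ≤ ∫ x in α..β, deriv g x ^ 2 / q x := by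
  have hw := h.weights
  have hsub := hw.ordConnected.out hα hβ
  set ψ : ℝ → ℝ := fun x => (P θ - P x) / matchFun I q P θ x with hψ
  have hψc : ContinuousOn ψ I := fun x hx =>
    (h.hasDerivAt_riccati hx).continuousAt.continuousWithinAt
  have hψ'c : ContinuousOn (fun x => -(f x * p x) / matchFun I q P θ x - q x * ψ x ^ 2) I :=
    ((h.prim.cont.mul hw.contLeft).neg.div h.continuousOn fun x hx => (h.pos hx).ne').sub
      (hw.contRight.mul (hψc.pow 2))
  have hψac := absolutelyContinuousOnInterval_of_hasDerivAt hw.ordConnected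
    (fun x hx => h.hasDerivAt_riccati hx) hψ'c hα hβ
  have hG := (hg.fun_mul hg).fun_mul hψac
  have hpg : IntervalIntegrable (fun x => lam * (p x * g x ^ 2)) volume α β := by
    refine ContinuousOn.intervalIntegrable (continuousOn_const.mul ((hw.contLeft.mono ?_).mul
      (hg.continuousOn.pow 2)))
    rwa [uIcc_of_le hαβ]
  have hmono : ∫ x in α..β, deriv (fun x => g x * g x * ψ x) x ≤
      ∫ x in α..β, (deriv g x ^ 2 / q x - lam * (p x * g x ^ 2)) := by
    refine intervalIntegral.integral_mono_ae_restrict hαβ hG.intervalIntegrable_deriv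
      (hi.sub hpg) ?_
    filter_upwards [ae_restrict_mem measurableSet_Icc, ae_restrict_of_ae hg.ae_differentiableAt]
      with x hx hd
    have hxI := hsub hx
    have hgd := (hd (by rwa [uIcc_of_le hαβ])).hasDerivAt
    have hprod : HasDerivAt (fun x => g x * g x * ψ x)
        ((deriv g x * g x + g x * deriv g x) * ψ x + g x * g x *
          (-(f x * p x) / matchFun I q P θ x - q x * ψ x ^ 2)) x :=
      (hgd.mul hgd).mul (h.hasDerivAt_riccati hxI)
    rw [hprod.deriv]
    have hq := hw.posRight x hxI
    have h1 : lam * p x * g x ^ 2 ≤ f x * p x / matchFun I q P θ x * g x ^ 2 := by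
      have : lam * p x ≤ f x * p x / matchFun I q P θ x := by
        rw [le_div_iff₀ (h.pos hxI)]
        nlinarith [hle x hxI, hw.posLeft x hxI]
      gcongr
    have h2 : 0 ≤ (deriv g x - q x * ψ x * g x) ^ 2 / q x := by positivity
    have h3 : (deriv g x - q x * ψ x * g x) ^ 2 / q x =
        deriv g x ^ 2 / q x - 2 * deriv g x * g x * ψ x + q x * ψ x ^ 2 * g x ^ 2 := by
      field_simp
      ring
    have h4 : -(f x * p x) / matchFun I q P θ x = -(f x * p x / matchFun I q P θ x) := neg_div _ _
    rw [h4]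
    linarith
  rw [hG.integral_deriv_eq_sub, intervalIntegral.integral_sub hi hpg,
    intervalIntegral.integral_const_mul] at hmono
  change _ + (g β ^ 2 * ψ β - g α ^ 2 * ψ α) ≤ _
  linarith

theorem continuousOn_of_absolutelyContinuous (hI : IsOpen I) {g : ℝ → ℝ}
    (hg : ∀ x ∈ I, ∀ y ∈ I, AbsolutelyContinuousOnInterval g x y) : ContinuousOn g I := by
  intro x hx
  obtain ⟨a, ha, hax⟩ := exists_mem_lt_of_isOpen hI hx
  obtain ⟨b, hb, hxb⟩ := exists_mem_gt_of_isOpen hI hx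
  have := (hg a ha b hb).continuousOn
  rw [uIcc_of_le (hax.trans hxb).le] at this
  exact (this.continuousAt (Icc_mem_nhds hax hxb)).continuousWithinAt

theorem intervalIntegrable_of_integrableOn (hO : I.OrdConnected) {g : ℝ → ℝ}
    (hg : IntegrableOn g I) {x y : ℝ} (hx : x ∈ I) (hy : y ∈ I) :
    IntervalIntegrable g volume x y :=
  (hg.mono_set (hO.uIcc_subset hx hy)).intervalIntegrable

theorem intervalIntegral_le_setIntegral (hO : I.OrdConnected) (hI : MeasurableSet I) {g : ℝ → ℝ}
    (hg : IntegrableOn g I) (h0 : ∀ x ∈ I, 0 ≤ g x) {x y : ℝ} (hx : x ∈ I) (hy : y ∈ I)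
    (hxy : x ≤ y) : ∫ t in x..y, g t ≤ ∫ t in I, g t := by
  rw [intervalIntegral.integral_of_le hxy]
  exact setIntegral_mono_set hg ((ae_restrict_mem hI).mono h0)
    (Ioc_subset_Icc_self.trans (hO.out hx hy)).eventuallyLE

/-- For a function vanishing at `α` and `β`, Barta's estimate has no boundary terms. -/
theorem IsMatched.dirichlet_bound (h : IsMatched I p q f P θ) {lam : ℝ}
    (hle : ∀ z ∈ I, lam * matchFun I q P θ z ≤ f z) {g : ℝ → ℝ} {α β : ℝ} (hα : α ∈ I) (hβ : β ∈ I)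
    (hαβ : α ≤ β) (hg : AbsolutelyContinuousOnInterval g α β) (hgα : g α = 0) (hgβ : g β = 0)
    (hi : IntegrableOn (fun x => deriv g x ^ 2 / q x) I) :
    lam * (∫ x in α..β, p x * g x ^ 2) ≤ ∫ x in I, deriv g x ^ 2 / q x := by
  have hw := h.weights
  have h1 := h.barta hle hα hβ hαβ hg (intervalIntegrable_of_integrableOn hw.ordConnected hi hα hβ)
  have h2 := intervalIntegral_le_setIntegral hw.ordConnected hw.isOpen.measurableSet hi
    (fun x hx => div_nonneg (sq_nonneg _) (hw.posRight x hx).le) hα hβ hαβ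
  rw [hgα, hgβ] at h1
  linarith

/-- The Cauchy–Schwarz inequality for the weight `q` on a set `s`. -/
theorem sq_setIntegral_mul_le {s : Set ℝ} (hs : MeasurableSet s) {φ : ℝ → ℝ}
    (h0 : ∀ x ∈ s, 0 ≤ q x) (hq : IntegrableOn q s)
    (h1 : IntegrableOn (fun x => q x * φ x) s) (h2 : IntegrableOn (fun x => q x * φ x ^ 2) s) :
    (∫ x in s, q x * φ x) ^ 2 ≤ (∫ x in s, q x) * ∫ x in s, q x * φ x ^ 2 := by
  have hquad : ∀ t : ℝ, 0 ≤ (∫ x in s, q x) * (t * t) + (-2 * ∫ x in s, q x * φ x) * t +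
      ∫ x in s, q x * φ x ^ 2 := fun t => by
    have hnn : 0 ≤ ∫ x in s, q x * (φ x - t) ^ 2 :=
      setIntegral_nonneg hs fun x hx => mul_nonneg (h0 x hx) (sq_nonneg _)
    have he : ∫ x in s, q x * (φ x - t) ^ 2 =
        ∫ x in s, ((t * t) * q x + (-2 * t) * (q x * φ x) + q x * φ x ^ 2) := by
      congr 1; funext x; ring
    have hadd : IntegrableOn (fun x => (t * t) * q x + (-2 * t) * (q x * φ x)) s :=
      (hq.const_mul _).add (h1.const_mul _)
    rw [he, integral_add hadd h2,
      integral_add (hq.const_mul _) (h1.const_mul _), integral_const_mul, integral_const_mul] at hnn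
    linarith
  have := discrim_le_zero hquad
  rw [discrim] at this
  linarith

section Neumann

variable {g : ℝ → ℝ}

/-- The estimate dual to the Neumann problem. For `g` of mean zero with respect to `q dx`, the
primitive `G` of `g q` vanishes at both ends. In Barta's estimate for `G` the boundary terms are
controlled by the Cauchy–Schwarz inequality and by `h α ≥ (P θ - P α) ∫_{-M}^α q`: they amount to
at most the part of `∫ q g²` that lies outside of `[α, β]`. -/
theorem IsMatched.dual_bound (h : IsMatched I p q f P θ) {lam : ℝ}
    (hle : ∀ z ∈ I, lam * matchFun I q P θ z ≤ f z) (hg : ContinuousOn g I)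
    (h1 : IntegrableOn (fun x => q x * g x) I) (hmean : ∫ x in I, q x * g x = 0)
    (h2 : IntegrableOn (fun x => q x * g x ^ 2) I) {α β : ℝ} (hα : α ∈ I) (hβ : β ∈ I)
    (hαθ : α ≤ θ) (hθβ : θ ≤ β) :
    lam * (∫ x in α..β, p x * (∫ t in I ∩ Iio x, q t * g t) ^ 2) ≤ ∫ x in I, q x * g x ^ 2 := by
  have hw := h.weights
  have hI := hw.isOpen.measurableSet
  have hc : ContinuousOn (fun x => q x * g x) I := hw.contRight.mul hg
  set G : ℝ → ℝ := fun x => ∫ t in I ∩ Iio x, q t * g t with hG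
  have hGd : ∀ x ∈ I, HasDerivAt G (q x * g x) x := fun x hx =>
    hasDerivAt_setIntegral_Iio hw.isOpen hw.ordConnected h1 hc hx
  have hsq : ∀ x ∈ I, deriv G x ^ 2 / q x = q x * g x ^ 2 := fun x hx => by
    have := hw.posRight x hx
    rw [(hGd x hx).deriv]
    field_simp
  have hi : IntegrableOn (fun x => deriv G x ^ 2 / q x) I :=
    h2.congr_fun (fun x hx => (hsq x hx).symm) hI
  have hb := h.barta hle hα hβ (hαθ.trans hθβ)
    (absolutelyContinuousOnInterval_of_hasDerivAt hw.ordConnected hGd hc hα hβ)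
    (intervalIntegrable_of_integrableOn hw.ordConnected hi hα hβ)
  have he : ∫ x in α..β, deriv G x ^ 2 / q x = ∫ x in α..β, q x * g x ^ 2 :=
    intervalIntegral.integral_congr fun x hx => hsq x (hw.ordConnected.uIcc_subset hα hβ hx)
  have hmono := (h.prim.strictMonoOn hw).monotoneOn
  have hbα : G α ^ 2 * ((P θ - P α) / matchFun I q P θ α) ≤
      ∫ x in I ∩ Iio α, q x * g x ^ 2 := by
    have hcs := sq_setIntegral_mul_le (hI.inter measurableSet_Iio)
      (fun x hx => (hw.posRight x hx.1).le) (h.finite.mono_set inter_subset_left)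
      (h1.mono_set inter_subset_left) (h2.mono_set (inter_subset_left (t := Iio α)))
    have hlow : (∫ x in I ∩ Iio α, q x) * (P θ - P α) ≤ matchFun I q P θ α := by
      rw [← integral_mul_const]
      refine setIntegral_mono_on ((h.finite.mono_set inter_subset_left).mul_const _)
        (h.integrable_integrand.mono_set inter_subset_left) (hI.inter measurableSet_Iio) ?_
      intro x hx
      have := hmono hx.1 hα (le_of_lt hx.2)
      have := hw.posRight x hx.1
      gcongr
    have hP : 0 ≤ P θ - P α := sub_nonneg.2 (hmono hα h.mem hαθ)
    have hS : 0 ≤ ∫ x in I ∩ Iio α, q x * g x ^ 2 :=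
      setIntegral_nonneg (hI.inter measurableSet_Iio)
        fun x hx => mul_nonneg (hw.posRight x hx.1).le (sq_nonneg _)
    rw [← mul_div_assoc, div_le_iff₀ (h.pos hα)]
    calc G α ^ 2 * (P θ - P α)
        ≤ ((∫ x in I ∩ Iio α, q x) * ∫ x in I ∩ Iio α, q x * g x ^ 2) * (P θ - P α) := by gcongr
      _ = (∫ x in I ∩ Iio α, q x * g x ^ 2) * ((∫ x in I ∩ Iio α, q x) * (P θ - P α)) := by ring
      _ ≤ _ := by gcongr
  have hbβ : -(G β ^ 2 * ((P θ - P β) / matchFun I q P θ β)) ≤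
      ∫ x in I ∩ Ioi β, q x * g x ^ 2 := by
    have hcs := sq_setIntegral_mul_le (hI.inter measurableSet_Ioi)
      (fun x hx => (hw.posRight x hx.1).le) (h.finite.mono_set inter_subset_left)
      (h1.mono_set inter_subset_left) (h2.mono_set (inter_subset_left (t := Ioi β)))
    have hGβ : G β ^ 2 = (∫ x in I ∩ Ioi β, q x * g x) ^ 2 := by
      rw [hG]
      simp only
      rw [setIntegral_Iio_add_Ioi hI h1 β, hmean, zero_sub, neg_sq]
    have hlow : (∫ x in I ∩ Ioi β, q x) * (P β - P θ) ≤ matchFun I q P θ β := by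
      rw [h.matchFun_eq_neg, ← integral_mul_const, ← integral_neg]
      refine setIntegral_mono_on ((h.finite.mono_set inter_subset_left).mul_const _)
        (h.integrable_integrand.mono_set inter_subset_left).neg (hI.inter measurableSet_Ioi) ?_
      intro x hx
      have h3 := hmono hβ hx.1 (le_of_lt hx.2)
      have h4 := hw.posRight x hx.1
      nlinarith
    have hP : 0 ≤ P β - P θ := sub_nonneg.2 (hmono h.mem hβ hθβ)
    have hS : 0 ≤ ∫ x in I ∩ Ioi β, q x * g x ^ 2 :=
      setIntegral_nonneg (hI.inter measurableSet_Ioi)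
        fun x hx => mul_nonneg (hw.posRight x hx.1).le (sq_nonneg _)
    rw [← mul_neg, ← neg_div, neg_sub, ← mul_div_assoc, div_le_iff₀ (h.pos hβ), hGβ]
    calc (∫ x in I ∩ Ioi β, q x * g x) ^ 2 * (P β - P θ)
        ≤ ((∫ x in I ∩ Ioi β, q x) * ∫ x in I ∩ Ioi β, q x * g x ^ 2) * (P β - P θ) := by gcongr
      _ = (∫ x in I ∩ Ioi β, q x * g x ^ 2) * ((∫ x in I ∩ Ioi β, q x) * (P β - P θ)) := by ring
      _ ≤ _ := by gcongr
  have hsplit := setIntegral_Iio_sub hw.ordConnected h2 hα hβ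
  rw [setIntegral_Iio_add_Ioi hI h2 β] at hsplit
  rw [he] at hb
  linarith

theorem lipschitzWith_clamp (R : ℝ) : LipschitzWith 1 fun x : ℝ => max (-R) (min R x) :=
  (LipschitzWith.id.const_min R).const_max (-R)

/-- The Neumann bound: `g` is paired with the primitive `G` of `g q` through
`∫ q g² = - ∫ g' G`, and `G` is estimated by the dual bound. Since `g` may be unbounded near the end
points, one factor `g` is truncated, so that the boundary terms of the integration by parts
vanish in the limit. -/
theorem IsMatched.neumann_bound (h : IsMatched I p q f P θ) {lam : ℝ} (hlam : 0 < lam)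
    (hle : ∀ z ∈ I, lam * matchFun I q P θ z ≤ f z)
    (hg : ∀ x ∈ I, ∀ y ∈ I, AbsolutelyContinuousOnInterval g x y)
    (h1 : IntegrableOn (fun x => q x * g x) I) (hmean : ∫ x in I, q x * g x = 0)
    (h2 : IntegrableOn (fun x => q x * g x ^ 2) I)
    (hD : IntegrableOn (fun x => deriv g x ^ 2 / p x) I) :
    lam * (∫ x in I, q x * g x ^ 2) ≤ ∫ x in I, deriv g x ^ 2 / p x := by
  have hw := h.weights
  have hI := hw.isOpen.measurableSet
  have hgc := continuousOn_of_absolutelyContinuous hw.isOpen hg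
  have hc : ContinuousOn (fun x => q x * g x) I := hw.contRight.mul hgc
  obtain ⟨α, β, hα, hβ, hαI, hβI, hαθ, hθβ, hex⟩ := exists_exhaustion hw.isOpen h.mem
  set G : ℝ → ℝ := fun x => ∫ t in I ∩ Iio x, q t * g t with hG
  have hGd : ∀ x ∈ I, HasDerivAt G (q x * g x) x := fun x hx =>
    hasDerivAt_setIntegral_Iio hw.isOpen hw.ordConnected h1 hc hx
  have hGc : ContinuousOn G I := fun x hx => (hGd x hx).continuousAt.continuousWithinAt
  set D := ∫ x in I, deriv g x ^ 2 / p x with hDdef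
  set S := ∫ x in I, q x * g x ^ 2 with hSdef
  have hαlt : ∀ x ∈ I, ∃ n, α n < x := fun x hx => (hex x hx).imp fun _ => And.left
  have hβlt : ∀ x ∈ I, ∃ n, x < β n := fun x hx => (hex x hx).imp fun _ => And.right
  have hGα := tendsto_setIntegral_Iio_left hI h1 hα hαlt
  have hGβ := tendsto_setIntegral_Iio_right hI h1 hβ hβlt
  rw [hmean] at hGβ
  -- Integration by parts against the truncation of `g` at the level `R`.
  have hparts : ∀ R : ℝ, 0 ≤ R → ∀ m,
      ∫ x in (α m)..(β m), max (-R) (min R (g x)) * (q x * g x) ≤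
        R * (|G (α m)| + |G (β m)|) + (D / (2 * lam) + S / 2) := by
    intro R hR m
    have hαβ := (hαθ m).trans (hθβ m)
    have hsub := hw.ordConnected.out (hαI m) (hβI m)
    have hgm := hg _ (hαI m) _ (hβI m)
    have hφ := absolutelyContinuousOnInterval_comp (lipschitzWith_clamp R) hgm
    have hGac := absolutelyContinuousOnInterval_of_hasDerivAt hw.ordConnected hGd hc (hαI m) (hβI m)
    have hibp := hφ.integral_mul_deriv_eq_deriv_mul hGac
    have he : ∫ x in (α m)..(β m), max (-R) (min R (g x)) * deriv G x =
        ∫ x in (α m)..(β m), max (-R) (min R (g x)) * (q x * g x) :=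
      intervalIntegral.integral_congr fun x hx => by
        simp only [(hGd x (hw.ordConnected.uIcc_subset (hαI m) (hβI m) hx)).deriv]
    have hDi := intervalIntegrable_of_integrableOn hw.ordConnected hD (hαI m) (hβI m)
    have hpG : IntervalIntegrable (fun x => p x * G x ^ 2) volume (α m) (β m) :=
      intervalIntegrable_of_continuousOn hw.ordConnected (hw.contLeft.mul (hGc.pow 2)) (hαI m)
        (hβI m)
    have hbound : ∫ x in (α m)..(β m), -(deriv (fun x => max (-R) (min R (g x))) x * G x) ≤
        ∫ x in (α m)..(β m),
          (1 / (2 * lam) * (deriv g x ^ 2 / p x) + lam / 2 * (p x * G x ^ 2)) := by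
      refine intervalIntegral.integral_mono_ae_restrict hαβ
        (hφ.intervalIntegrable_deriv.mul_continuousOn hGac.continuousOn).neg
        ((hDi.const_mul _).add (hpG.const_mul _)) ?_
      filter_upwards [ae_restrict_mem measurableSet_Icc, ae_restrict_of_ae hgm.ae_differentiableAt,
        ae_restrict_of_ae hφ.ae_differentiableAt] with x hx hd hd'
      have hu : x ∈ uIcc (α m) (β m) := by rwa [uIcc_of_le hαβ]
      have habs := abs_deriv_comp_le (lipschitzWith_clamp R) (hd hu).hasDerivAt (hd' hu).hasDerivAt
      have hp := hw.posLeft x (hsub hx)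
      have h3 : -(deriv (fun x => max (-R) (min R (g x))) x * G x) ≤ |deriv g x| * |G x| :=
        (neg_le_abs _).trans (by rw [abs_mul]; gcongr)
      have h4 : 0 ≤ (|deriv g x| - lam * p x * |G x|) ^ 2 / (2 * lam * p x) := by positivity
      have h5 : (|deriv g x| - lam * p x * |G x|) ^ 2 / (2 * lam * p x) =
          1 / (2 * lam) * (deriv g x ^ 2 / p x) + lam / 2 * (p x * G x ^ 2) -
            |deriv g x| * |G x| := by
        rw [← sq_abs (deriv g x), ← sq_abs (G x)]
        field_simp
        ring
      linarith
    rw [intervalIntegral.integral_neg, intervalIntegral.integral_add (hDi.const_mul _)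
      (hpG.const_mul _), intervalIntegral.integral_const_mul,
      intervalIntegral.integral_const_mul] at hbound
    have hdual := h.dual_bound hle hgc h1 hmean h2 (hαI m) (hβI m) (hαθ m) (hθβ m)
    have hDle := intervalIntegral_le_setIntegral hw.ordConnected hI hD
      (fun x hx => div_nonneg (sq_nonneg _) (hw.posLeft x hx).le) (hαI m) (hβI m) hαβ
    have habs : ∀ t, |max (-R) (min R t)| ≤ R := fun t =>
      abs_le.2 ⟨le_max_left _ _, max_le (by linarith) (min_le_left _ _)⟩
    have hb1 : max (-R) (min R (g (β m))) * G (β m) ≤ R * |G (β m)| :=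
      (le_abs_self _).trans (by rw [abs_mul]; gcongr; exact habs _)
    have hb2 : -(max (-R) (min R (g (α m))) * G (α m)) ≤ R * |G (α m)| :=
      (neg_le_abs _).trans (by rw [abs_mul]; gcongr; exact habs _)
    have hD2 : 1 / (2 * lam) * (∫ x in (α m)..(β m), deriv g x ^ 2 / p x) ≤ D / (2 * lam) := by
      rw [one_div_mul_eq_div]
      gcongr
    have hS2 : lam / 2 * (∫ x in (α m)..(β m), p x * G x ^ 2) ≤ S / 2 := by linarith
    rw [← he, hibp]
    linarith
  have hfix : ∀ n, ∫ x in (α n)..(β n), q x * g x ^ 2 ≤ D / (2 * lam) + S / 2 := by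
    intro n
    have hαβ := (hαθ n).trans (hθβ n)
    have hsub := hw.ordConnected.out (hαI n) (hβI n)
    obtain ⟨R, hR⟩ := isCompact_Icc.exists_bound_of_continuousOn (hgc.mono hsub)
    have hR0 : 0 ≤ R := (norm_nonneg _).trans (hR _ (left_mem_Icc.2 hαβ))
    have hlim : Tendsto (fun m => R * (|G (α m)| + |G (β m)|) + (D / (2 * lam) + S / 2)) atTop
        (𝓝 (R * (|0| + |0|) + (D / (2 * lam) + S / 2))) :=
      ((hGα.abs.add hGβ.abs).const_mul R).add_const _
    rw [abs_zero, add_zero, mul_zero, zero_add] at hlim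
    refine ge_of_tendsto hlim ?_
    filter_upwards [eventually_ge_atTop n] with m hm
    refine le_trans ?_ (hparts R hR0 m)
    have hc' : ContinuousOn (fun x => max (-R) (min R (g x)) * (q x * g x)) I :=
      ((lipschitzWith_clamp R).continuous.comp_continuousOn hgc).mul hc
    have heq : ∫ x in (α n)..(β n), q x * g x ^ 2 =
        ∫ x in (α n)..(β n), max (-R) (min R (g x)) * (q x * g x) := by
      refine intervalIntegral.integral_congr fun x hx => ?_
      rw [uIcc_of_le hαβ] at hx
      have := abs_le.1 (hR x hx)
      simp only [min_eq_right this.2, max_eq_right this.1]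
      ring
    rw [heq]
    refine intervalIntegral.integral_mono_interval (hα hm) hαβ (hβ hm) ?_
      (intervalIntegrable_of_continuousOn hw.ordConnected hc' (hαI m) (hβI m))
    refine (ae_restrict_mem measurableSet_Ioc).mono fun x hx => ?_
    have hq := hw.posRight x (hw.ordConnected.out (hαI m) (hβI m) (Ioc_subset_Icc_self hx))
    have hsign : 0 ≤ max (-R) (min R (g x)) * g x := by
      rcases le_total 0 (g x) with h0 | h0
      · exact mul_nonneg (le_max_of_le_right (le_min hR0 h0)) h0
      · exact mul_nonneg_of_nonpos_of_nonpos (max_le (by linarith) (min_le_of_right_le h0)) h0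
    have : max (-R) (min R (g x)) * (q x * g x) = q x * (max (-R) (min R (g x)) * g x) := by ring
    change 0 ≤ max (-R) (min R (g x)) * (q x * g x)
    rw [this]
    exact mul_nonneg hq.le hsign
  have hlimS : Tendsto (fun n => ∫ x in (α n)..(β n), q x * g x ^ 2) atTop (𝓝 S) := by
    have := (tendsto_setIntegral_Iio_right hI h2 hβ hβlt).sub
      (tendsto_setIntegral_Iio_left hI h2 hα hαlt)
    rw [sub_zero] at this
    refine this.congr fun n => ?_
    rw [setIntegral_Iio_sub hw.ordConnected h2 (hαI n) (hβI n)]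
    ring
  have hfin := le_of_tendsto' hlimS hfix
  have : S ≤ D / lam := by
    have h6 : D / (2 * lam) = D / lam / 2 := by field_simp
    linarith
  rw [le_div_iff₀ hlam] at this
  linarith

end Neumann

end

/-! ### Test functions from oscillating solutions -/

theorem lintegral_eq_ofReal_intervalIntegral (hI : MeasurableSet I) (hO : I.OrdConnected) {α β : ℝ}
    (hα : α ∈ I) (hβ : β ∈ I) (hαβ : α ≤ β) {F : ℝ → ℝ≥0∞} {k : ℝ → ℝ} (hk : ContinuousOn k I)
    (hk0 : ∀ x ∈ I, 0 ≤ k x) (hin : ∀ x ∈ Ioo α β, F x = ENNReal.ofReal (k x))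
    (hout : ∀ x ∈ I, x < α ∨ β < x → F x = 0) :
    ∫⁻ x in I, F x = ENNReal.ofReal (∫ x in α..β, k x) := by
  have hsub : Ioo α β ⊆ I := Ioo_subset_Icc_self.trans (hO.out hα hβ)
  have hae : F =ᵐ[volume.restrict I] (Ioo α β).indicator fun x => ENNReal.ofReal (k x) := by
    have hnull : ∀ᵐ x ∂(volume.restrict I), x ∉ ({α, β} : Set ℝ) :=
      ae_restrict_of_ae (measure_eq_zero_iff_ae_notMem.1 ((Set.toFinite _).measure_zero _))
    filter_upwards [hnull, ae_restrict_mem hI] with x hx hxE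
    simp only [mem_insert_iff, mem_singleton_iff, not_or] at hx
    by_cases hxI : x ∈ Ioo α β
    · rw [indicator_of_mem hxI, hin x hxI]
    · rw [indicator_of_notMem hxI]
      refine hout x hxE ?_
      by_contra! h
      exact hxI ⟨lt_of_le_of_ne h.1 (Ne.symm hx.1), lt_of_le_of_ne h.2 hx.2⟩
  rw [lintegral_congr_ae hae, lintegral_indicator measurableSet_Ioo,
    Measure.restrict_restrict measurableSet_Ioo, inter_eq_self_of_subset_left hsub,
    intervalIntegral.integral_of_le hαβ, integral_Ioc_eq_integral_Ioo,
    ofReal_integral_eq_lintegral_ofReal]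
  · exact ((hk.mono (hO.out hα hβ)).integrableOn_Icc).mono_set Ioo_subset_Icc_self
  · exact (ae_restrict_mem measurableSet_Ioo).mono fun x hx => hk0 x (hsub hx)

/-- The function which agrees with `w` on `[α, β]` and is constant on either side. -/
def clampExt (w : ℝ → ℝ) (α β x : ℝ) : ℝ :=
  w (max α (min β x))

section Clamp

variable {w w' : ℝ → ℝ} {α β : ℝ}

theorem clampExt_of_mem {x : ℝ} (hx : x ∈ Icc α β) : clampExt w α β x = w x := by
  rw [clampExt, min_eq_right hx.2, max_eq_right hx.1]

theorem clampExt_of_lt {x : ℝ} (hx : x < α) (hαβ : α ≤ β) : clampExt w α β x = w α := by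
  rw [clampExt, min_eq_right (hx.le.trans hαβ), max_eq_left hx.le]

theorem clampExt_of_gt {x : ℝ} (hx : β < x) (hαβ : α ≤ β) : clampExt w α β x = w β := by
  rw [clampExt, min_eq_left hx.le, max_eq_right hαβ]

theorem exists_lipschitzWith_clampExt (hO : I.OrdConnected) (hw : ∀ x ∈ I, HasDerivAt w (w' x) x)
    (hw' : ContinuousOn w' I) (hα : α ∈ I) (hβ : β ∈ I) (hαβ : α ≤ β) :
    ∃ K, LipschitzWith K (clampExt w α β) := by
  obtain ⟨K, hK⟩ := exists_lipschitzOnWith_of_hasDerivAt hO hw hw' hα hβ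
  have hcl : LipschitzWith 1 fun x : ℝ => max α (min β x) :=
    (LipschitzWith.id.const_min β).const_max α
  have h := hK.comp (lipschitzOnWith_univ.2 hcl) fun x _ => by
    rw [uIcc_of_le hαβ]
    exact ⟨le_max_left _ _, max_le hαβ (min_le_left _ _)⟩
  exact ⟨_, lipschitzOnWith_univ.1 h⟩

theorem lintegral_sq_deriv_clampExt (hI : MeasurableSet I) (hO : I.OrdConnected)
    (hw : ∀ x ∈ I, HasDerivAt w (w' x) x) (hw' : ContinuousOn w' I) (hα : α ∈ I) (hβ : β ∈ I)
    (hαβ : α ≤ β) {r : ℝ → ℝ} (hr : ContinuousOn r I) (hr0 : ∀ x ∈ I, 0 < r x) :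
    ∫⁻ x in I, ENNReal.ofReal (deriv (clampExt w α β) x ^ 2 / r x) =
      ENNReal.ofReal (∫ x in α..β, w' x ^ 2 / r x) := by
  refine lintegral_eq_ofReal_intervalIntegral hI hO hα hβ hαβ
    ((hw'.pow 2).div hr fun x hx => (hr0 x hx).ne')
    (fun x hx => div_nonneg (sq_nonneg _) (hr0 x hx).le) (fun x hx => ?_) fun x _ hx => ?_
  · have h : clampExt w α β =ᶠ[𝓝 x] w := by
      filter_upwards [Ioo_mem_nhds hx.1 hx.2] with y hy
      exact clampExt_of_mem (Ioo_subset_Icc_self hy)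
    rw [h.deriv_eq, (hw x (hO.out hα hβ (Ioo_subset_Icc_self hx))).deriv]
  · have h : deriv (clampExt w α β) x = 0 := by
      rcases hx with hx | hx
      · have h : clampExt w α β =ᶠ[𝓝 x] fun _ => w α := by
          filter_upwards [Iio_mem_nhds hx] with y hy
          exact clampExt_of_lt hy hαβ
        rw [h.deriv_eq, deriv_const]
      · have h : clampExt w α β =ᶠ[𝓝 x] fun _ => w β := by
          filter_upwards [Ioi_mem_nhds hx] with y hy
          exact clampExt_of_gt hy hαβ
        rw [h.deriv_eq, deriv_const]
    simp [h]

end Clamp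

theorem lintegral_sq_deriv_const_mul {r φ : ℝ → ℝ} (t : ℝ) :
    ∫⁻ x in I, ENNReal.ofReal (deriv (fun x => t * φ x) x ^ 2 / r x) =
      ENNReal.ofReal (t ^ 2) * ∫⁻ x in I, ENNReal.ofReal (deriv φ x ^ 2 / r x) := by
  rw [← lintegral_const_mul' _ _ ENNReal.ofReal_ne_top]
  refine lintegral_congr fun x => ?_
  rw [deriv_const_mul_field, mul_pow, mul_div_assoc, ENNReal.ofReal_mul (sq_nonneg t)]

theorem lintegral_mul_sq_const_mul {r φ : ℝ → ℝ} (t : ℝ) :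
    ∫⁻ x in I, ENNReal.ofReal (r x * (t * φ x) ^ 2) =
      ENNReal.ofReal (t ^ 2) * ∫⁻ x in I, ENNReal.ofReal (r x * φ x ^ 2) := by
  rw [← lintegral_const_mul' _ _ ENNReal.ofReal_ne_top]
  refine lintegral_congr fun x => ?_
  rw [← ENNReal.ofReal_mul (sq_nonneg t)]
  congr 1; ring

/-- Integration by parts between two zeros of `u`. -/
theorem IsSolution.integral_sq_eq (hw : Weights I p q) {lam : ℝ} {u v : ℝ → ℝ}
    (hu : IsSolution I p q lam u v) {α β : ℝ} (hα : α ∈ I) (hβ : β ∈ I) (huα : u α = 0)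
    (huβ : u β = 0) :
    ∫ x in α..β, q x * v x ^ 2 = lam * ∫ x in α..β, p x * u x ^ 2 := by
  have hc1 : ContinuousOn (fun x => q x * v x ^ 2) I := hw.contRight.mul (hu.continuousOn.2.pow 2)
  have hc2 : ContinuousOn (fun x => lam * (p x * u x ^ 2)) I :=
    continuousOn_const.mul (hw.contLeft.mul (hu.continuousOn.1.pow 2))
  have h := integral_eq_sub_of_hasDerivAt_on hw.ordConnected (F := fun x => u x * v x)
    (F' := fun x => q x * v x ^ 2 - lam * (p x * u x ^ 2))
    (fun x hx => ((hu x hx).1.mul (hu x hx).2).congr_deriv (by ring)) (hc1.sub hc2) hα hβ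
  rw [intervalIntegral.integral_sub (intervalIntegrable_of_continuousOn hw.ordConnected hc1 hα hβ)
    (intervalIntegrable_of_continuousOn hw.ordConnected hc2 hα hβ),
    intervalIntegral.integral_const_mul, huα, huβ] at h
  linarith

theorem integral_mul_sq_pos (hw : Weights I p q) {u : ℝ → ℝ} (hu : ContinuousOn u I) {α β : ℝ}
    (hα : α ∈ I) (hβ : β ∈ I) (hαβ : α < β) (hpos : ∀ x ∈ Ioo α β, 0 < u x) :
    0 < ∫ x in α..β, p x * u x ^ 2 := by
  refine intervalIntegral.intervalIntegral_pos_of_pos_on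
    (intervalIntegrable_of_continuousOn hw.ordConnected (hw.contLeft.mul (hu.pow 2)) hα hβ)
    (fun x hx => ?_) hαβ
  have := hpos x hx
  have := hw.posLeft x (hw.ordConnected.out hα hβ (Ioo_subset_Icc_self hx))
  positivity

/-- A solution `u` that is positive between two zeros, extended by zero, is a test function for the
Dirichlet eigenvalue with Rayleigh quotient `lam`. -/
theorem exists_dirichlet_test (hw : Weights I p q) {lam : ℝ} (hlam : 0 < lam)
    (hno : ¬NonOscillating I p q lam) :
    ∃ g : ℝ → ℝ, (∀ x y, AbsolutelyContinuousOnInterval g x y) ∧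
      (∃ K : Set ℝ, IsCompact K ∧ K ⊆ I ∧ ∀ x ∈ I \ K, g x = 0) ∧
      ∫⁻ x in I, ENNReal.ofReal (p x * g x ^ 2) = 1 ∧
      ∫⁻ x in I, ENNReal.ofReal (deriv g x ^ 2 / q x) ≤ ENNReal.ofReal lam := by
  simp only [NonOscillating, not_forall, not_false_eq_true, exists_prop, and_true] at hno
  obtain ⟨u, v, hu, α, hα, β, hβ, hαβ, huα, huβ, hpos⟩ := hno
  have hqv : ContinuousOn (fun x => q x * v x) I := hw.contRight.mul hu.continuousOn.2
  have hA := integral_mul_sq_pos hw hu.continuousOn.1 hα hβ hαβ hpos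
  set A := ∫ x in α..β, p x * u x ^ 2 with hAdef
  obtain ⟨K, hK⟩ := exists_lipschitzWith_clampExt hw.ordConnected (fun x hx => (hu x hx).1) hqv
    hα hβ hαβ.le
  have hzero : ∀ x, x < α ∨ β < x → clampExt u α β x = 0 := fun x hx => by
    rcases hx with hx | hx
    · rw [clampExt_of_lt hx hαβ.le, huα]
    · rw [clampExt_of_gt hx hαβ.le, huβ]
  have hsq : (√A)⁻¹ ^ 2 = A⁻¹ := by rw [inv_pow, Real.sq_sqrt hA.le]
  refine ⟨fun x => (√A)⁻¹ * clampExt u α β x, fun x y =>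
    (hK.lipschitzOnWith).absolutelyContinuousOnInterval.const_mul _,
    ⟨Icc α β, isCompact_Icc, hw.ordConnected.out hα hβ, fun x hx => ?_⟩, ?_, ?_⟩
  · have hx' : x < α ∨ β < x := by
      by_contra! h
      exact hx.2 h
    simp only [hzero x hx', mul_zero]
  · rw [lintegral_mul_sq_const_mul, hsq, lintegral_eq_ofReal_intervalIntegral
      hw.isOpen.measurableSet hw.ordConnected hα hβ hαβ.le
      (hw.contLeft.mul (hu.continuousOn.1.pow 2))
      (fun x hx => mul_nonneg (hw.posLeft x hx).le (sq_nonneg _))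
      (fun x hx => by rw [clampExt_of_mem (Ioo_subset_Icc_self hx)]; rfl)
      (fun x _ hx => by rw [hzero x hx]; simp), ← ENNReal.ofReal_mul (by positivity)]
    change ENNReal.ofReal (A⁻¹ * A) = 1
    rw [inv_mul_cancel₀ hA.ne', ENNReal.ofReal_one]
  · rw [lintegral_sq_deriv_const_mul, hsq, lintegral_sq_deriv_clampExt hw.isOpen.measurableSet
      hw.ordConnected
      (fun x hx => (hu x hx).1) hqv hα hβ hαβ.le hw.contRight hw.posRight,
      ← ENNReal.ofReal_mul (by positivity)]
    refine ENNReal.ofReal_le_ofReal (le_of_eq ?_)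
    have h1 : ∫ x in α..β, (q x * v x) ^ 2 / q x = ∫ x in α..β, q x * v x ^ 2 :=
      intervalIntegral.integral_congr fun x hx => by
        have := hw.posRight x (hw.ordConnected.uIcc_subset hα hβ hx)
        field_simp
    rw [h1, hu.integral_sq_eq hw hα hβ huα huβ]
    change A⁻¹ * (lam * A) = lam
    field_simp

/-- Extending a function by constants outside of an interval `J` on which it has mean zero does not
decrease its variance, by the Cauchy–Schwarz inequality on the complement of `J`. -/
theorem setIntegral_sq_le_variance (hI : MeasurableSet I) (h0 : ∀ x ∈ I, 0 < q x)
    (hq : IntegrableOn q I) (hQ : 0 < ∫ x in I, q x) {φ : ℝ → ℝ} {J : Set ℝ} (hJ : MeasurableSet J)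
    (hJI : J ⊆ I) (h1 : IntegrableOn (fun x => q x * φ x) I)
    (h2 : IntegrableOn (fun x => q x * φ x ^ 2) I) (hmean : ∫ x in J, q x * φ x = 0) :
    ∫ x in J, q x * φ x ^ 2 ≤
      ∫ x in I, q x * (φ x - (∫ x in I, q x * φ x) / ∫ x in I, q x) ^ 2 := by
  have hcs := sq_setIntegral_mul_le (hI.diff hJ) (fun x hx => (h0 x hx.1).le)
    (hq.mono_set sdiff_subset) (h1.mono_set sdiff_subset) (h2.mono_set (sdiff_subset (t := J)))
  rw [setIntegral_sdiff hJ h1 hJI, hmean, sub_zero, setIntegral_sdiff hJ h2 hJI,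
    setIntegral_sdiff hJ hq hJI] at hcs
  have hQJ : 0 ≤ ∫ x in J, q x := setIntegral_nonneg hJ fun x hx => (h0 x (hJI hx)).le
  have hmono : ∫ x in J, q x * φ x ^ 2 ≤ ∫ x in I, q x * φ x ^ 2 :=
    setIntegral_mono_set h2 ((ae_restrict_mem hI).mono fun x hx =>
      mul_nonneg (h0 x hx).le (sq_nonneg _)) hJI.eventuallyLE
  set A := ∫ x in I, q x * φ x
  set Q := ∫ x in I, q x
  set T := ∫ x in I, q x * φ x ^ 2
  set B := ∫ x in J, q x * φ x ^ 2
  have hvar : ∫ x in I, q x * (φ x - A / Q) ^ 2 = T - A ^ 2 / Q := by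
    have he : ∫ x in I, q x * (φ x - A / Q) ^ 2 =
        ∫ x in I, ((A / Q) ^ 2 * q x + (-2 * (A / Q)) * (q x * φ x) + q x * φ x ^ 2) := by
      congr 1; funext x; ring
    have hadd : IntegrableOn (fun x => (A / Q) ^ 2 * q x + (-2 * (A / Q)) * (q x * φ x)) I :=
      (hq.const_mul _).add (h1.const_mul _)
    rw [he, integral_add hadd h2, integral_add (hq.const_mul _) (h1.const_mul _),
      integral_const_mul, integral_const_mul]
    change (A / Q) ^ 2 * Q + -2 * (A / Q) * A + T = _
    field_simp
    ring
  rw [hvar]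
  have h3 : A ^ 2 / Q ≤ T - B := by
    rw [div_le_iff₀ hQ]
    nlinarith
  linarith

/-- If a solution `u` is positive between two zeros `α < β`, then `v = u' / q`, extended by
constants outside of `[α, β]` and centred, is a test function for the Neumann eigenvalue of the
operator with the two weights exchanged, and its Rayleigh quotient is at most `lam`. -/
theorem exists_neumann_test (hw : Weights I p q) (hq : IntegrableOn q I) {lam : ℝ} (hlam : 0 < lam)
    (hno : ¬NonOscillating I p q lam) :
    ∃ g : ℝ → ℝ, (∀ x y, AbsolutelyContinuousOnInterval g x y) ∧
      IntegrableOn (fun x => q x * g x) I ∧ ∫ x in I, q x * g x = 0 ∧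
      ∫⁻ x in I, ENNReal.ofReal (q x * g x ^ 2) = 1 ∧
      ∫⁻ x in I, ENNReal.ofReal (deriv g x ^ 2 / p x) ≤ ENNReal.ofReal lam := by
  simp only [NonOscillating, not_forall, not_false_eq_true, exists_prop, and_true] at hno
  obtain ⟨u, v, hu, α, hα, β, hβ, hαβ, huα, huβ, hpos⟩ := hno
  have hI := hw.isOpen.measurableSet
  have hpu : ContinuousOn (fun x => -(lam * p x * u x)) I :=
    ((continuousOn_const.mul hw.contLeft).mul hu.continuousOn.1).neg
  have hA := integral_mul_sq_pos hw hu.continuousOn.1 hα hβ hαβ hpos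
  have hid := hu.integral_sq_eq hw hα hβ huα huβ
  set A := ∫ x in α..β, p x * u x ^ 2 with hAdef
  obtain ⟨K, hK⟩ := exists_lipschitzWith_clampExt hw.ordConnected (fun x hx => (hu x hx).2) hpu
    hα hβ hαβ.le
  have hcφ := hK.continuous
  have hclamp : ∀ x, max α (min β x) ∈ Icc α β := fun x =>
    ⟨le_max_left _ _, max_le hαβ.le (min_le_left _ _)⟩
  obtain ⟨R, hR⟩ := isCompact_Icc.exists_bound_of_continuousOn
    (hu.continuousOn.2.mono (hw.ordConnected.out hα hβ))
  have hRφ : ∀ x, ‖clampExt v α β x‖ ≤ R := fun x => hR _ (hclamp x)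
  set φ := clampExt v α β with hφ
  have h1 : IntegrableOn (fun x => q x * φ x) I :=
    Integrable.mul_bdd hq hcφ.aestronglyMeasurable (ae_of_all _ hRφ)
  have h2 : IntegrableOn (fun x => q x * φ x ^ 2) I :=
    (Integrable.mul_bdd h1 hcφ.aestronglyMeasurable (ae_of_all _ hRφ)).congr
      (ae_of_all _ fun x => by simp only; ring)
  have hJI : Ioc α β ⊆ I := Ioc_subset_Icc_self.trans (hw.ordConnected.out hα hβ)
  have hmean : ∫ x in Ioc α β, q x * φ x = 0 := by
    have he : ∫ x in Ioc α β, q x * φ x = ∫ x in Ioc α β, q x * v x :=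
      setIntegral_congr_fun measurableSet_Ioc fun x hx => by
        simp only [hφ, clampExt_of_mem (Ioc_subset_Icc_self hx)]
    rw [he, ← intervalIntegral.integral_of_le hαβ.le,
      integral_eq_sub_of_hasDerivAt_on hw.ordConnected (fun x hx => (hu x hx).1)
      (hw.contRight.mul hu.continuousOn.2) hα hβ, huα, huβ, sub_zero]
  have hQ := setIntegral_pos_of_isOpen hw.isOpen hw.nonempty hq hw.posRight
  have hvar := setIntegral_sq_le_variance hI hw.posRight hq hQ measurableSet_Ioc hJI h1 h2 hmean
  have hB : ∫ x in Ioc α β, q x * φ x ^ 2 = lam * A := by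
    rw [← hid, intervalIntegral.integral_of_le hαβ.le]
    exact setIntegral_congr_fun measurableSet_Ioc fun x hx => by
      simp only [hφ, clampExt_of_mem (Ioc_subset_Icc_self hx)]
  rw [hB] at hvar
  set m := (∫ x in I, q x * φ x) / ∫ x in I, q x with hm
  set V := ∫ x in I, q x * (φ x - m) ^ 2 with hV
  have hVpos : 0 < V := (mul_pos hlam hA).trans_le hvar
  have hi1 : IntegrableOn (fun x => q x * (φ x - m)) I :=
    (h1.sub (hq.mul_const m)).congr (ae_of_all _ fun x => by simp only [Pi.sub_apply]; ring)
  have hi2 : IntegrableOn (fun x => q x * (φ x - m) ^ 2) I := by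
    refine (Integrable.mul_bdd (c := R + |m|) (g := fun x => φ x - m) hi1
      (hcφ.sub continuous_const).aestronglyMeasurable
      (ae_of_all _ fun x => ?_)).congr (ae_of_all _ fun x => ?_)
    · exact (norm_sub_le _ _).trans (add_le_add_left (hRφ x) _)
    · simp only; ring
  have hsq : (√V)⁻¹ ^ 2 = V⁻¹ := by rw [inv_pow, Real.sq_sqrt hVpos.le]
  refine ⟨fun x => (√V)⁻¹ * (φ x - m), fun x y => ?_, ?_, ?_, ?_, ?_⟩
  · have hconst : LipschitzWith 0 fun _ : ℝ => m := LipschitzWith.const m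
    exact ((hK.sub hconst).lipschitzOnWith).absolutelyContinuousOnInterval.const_mul _
  · exact (hi1.const_mul (√V)⁻¹).congr (ae_of_all _ fun x => by simp only; ring)
  · have he : ∫ x in I, q x * ((√V)⁻¹ * (φ x - m)) = (√V)⁻¹ * ∫ x in I, q x * (φ x - m) := by
      rw [← integral_const_mul]
      congr 1; funext x; ring
    have he' : ∫ x in I, q x * (φ x - m) = (∫ x in I, q x * φ x) - (∫ x in I, q x) * m := by
      rw [← integral_mul_const, ← integral_sub h1 (hq.mul_const m)]
      congr 1; funext x; ring
    rw [he, he', hm, mul_div_cancel₀ _ hQ.ne', sub_self, mul_zero]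
  · rw [lintegral_mul_sq_const_mul, hsq, ← ofReal_integral_eq_lintegral_ofReal hi2
      ((ae_restrict_mem hI).mono fun x hx => mul_nonneg (hw.posRight x hx).le (sq_nonneg _)),
      ← ENNReal.ofReal_mul (by positivity), inv_mul_cancel₀ hVpos.ne', ENNReal.ofReal_one]
  · have hd : deriv (fun x => φ x - m) = deriv φ := by
      funext x
      rw [deriv_sub_const]
    rw [lintegral_sq_deriv_const_mul, hsq, hd, lintegral_sq_deriv_clampExt hw.isOpen.measurableSet
      hw.ordConnected
      (fun x hx => (hu x hx).2) hpu hα hβ hαβ.le hw.contLeft hw.posLeft,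
      ← ENNReal.ofReal_mul (by positivity)]
    refine ENNReal.ofReal_le_ofReal ?_
    have h3 : ∫ x in α..β, (-(lam * p x * u x)) ^ 2 / p x = lam * (lam * A) := by
      rw [hAdef, ← intervalIntegral.integral_const_mul, ← intervalIntegral.integral_const_mul]
      refine intervalIntegral.integral_congr fun x hx => ?_
      have := hw.posLeft x (hw.ordConnected.uIcc_subset hα hβ hx)
      field_simp
    rw [h3, inv_mul_le_iff₀ hVpos, mul_comm V]
    gcongr

/-! ### The variational formula for a pair of weights -/

variable {M N : EReal}

theorem existsUnique_isMatchingPoint (hw : Weights (E M N) p q)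
    (hq : weightedMeasure (E M N) q (E M N) < ∞) {f : ℝ → ℝ} (hf : f ∈ CPlus M N)
    (hfin : HFinite M N (weightedMeasure (E M N) p) (weightedMeasure (E M N) q) f) :
    ∃! θ : ℝ, IsMatchingPoint M N (weightedMeasure (E M N) p) (weightedMeasure (E M N) q) f θ := by
  rw [weightedMeasure_lt_top_iff hw.isOpen.measurableSet hw.contRight hw.posRight] at hq
  obtain ⟨P, hP⟩ := exists_isPrimitive hw hf.1 hf.2
  obtain ⟨s, hs, hs'⟩ := hfin
  have hi := (hP.hFinite_iff hw hq hs).1 hs'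
  obtain ⟨θ, ⟨hθ, h0⟩, huniq⟩ := hP.existsUnique_matching hw hq hi
  exact ⟨θ, ⟨hθ, (hP.matching_iff hw hq hθ).2 ⟨hi, h0⟩⟩,
    fun η hη => huniq η ⟨hη.1, ((hP.matching_iff hw hq hη.1).1 hη.2).2⟩⟩

theorem IsMatched.ofReal_le_variationalSup {f P : ℝ → ℝ} {θ : ℝ}
    (h : IsMatched (E M N) p q f P θ) {lam : ℝ}
    (hle : ∀ z ∈ E M N, lam * matchFun (E M N) q P θ z ≤ f z) :
    ENNReal.ofReal lam ≤
      variationalSup M N (weightedMeasure (E M N) p) (weightedMeasure (E M N) q) := by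
  refine ((h.ofReal_le_variationalValue_iff lam).2 hle).trans ?_
  have hm : IsMatchingPoint M N (weightedMeasure (E M N) p) (weightedMeasure (E M N) q) f θ :=
    ⟨h.mem, (h.prim.matching_iff h.weights h.finite h.mem).2 ⟨h.integrable, h.integral_eq_zero⟩⟩
  exact le_iSup₂_of_le f ⟨h.prim.cont, h.prim.pos⟩ (le_iSup₂_of_le θ hm le_rfl)

/-- The variational supremum equals `L` if every admissible `f` gives a lower bound of `L`, and
every `lam < L` makes the eigenvalue equation nonoscillating. -/
theorem eq_variationalSup (hw : Weights (E M N) p q)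
    (hq : weightedMeasure (E M N) q (E M N) < ∞) {L : ℝ≥0∞}
    (hlow : ∀ (f P : ℝ → ℝ) (θ lam : ℝ), IsMatched (E M N) p q f P θ → 0 < lam →
      (∀ z ∈ E M N, lam * matchFun (E M N) q P θ z ≤ f z) → ENNReal.ofReal lam ≤ L)
    (hup : ∀ lam : ℝ, 0 < lam → ENNReal.ofReal lam < L → NonOscillating (E M N) p q lam) :
    L = variationalSup M N (weightedMeasure (E M N) p) (weightedMeasure (E M N) q) := by
  rw [weightedMeasure_lt_top_iff hw.isOpen.measurableSet hw.contRight hw.posRight] at hq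
  refine le_antisymm (ENNReal.le_of_forall_nnreal_lt fun r hr => ?_)
    (iSup₂_le fun f hf => iSup₂_le fun θ hθ => ENNReal.le_of_forall_nnreal_lt fun r hr => ?_)
  · rcases eq_or_ne r 0 with rfl | hr0
    · simp
    have hpos : (0 : ℝ) < r := by exact_mod_cast pos_iff_ne_zero.2 hr0
    have hr' : ENNReal.ofReal (r : ℝ) = r := ENNReal.ofReal_coe_nnreal
    rw [← hr'] at hr ⊢
    obtain ⟨f, P, θ, hm, hle⟩ := (hup r hpos hr).exists_le_matchFun hw hq hpos
    exact hm.ofReal_le_variationalSup hle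
  · rcases eq_or_ne r 0 with rfl | hr0
    · simp
    have hpos : (0 : ℝ) < r := by exact_mod_cast pos_iff_ne_zero.2 hr0
    have hr' : ENNReal.ofReal (r : ℝ) = r := ENNReal.ofReal_coe_nnreal
    rw [← hr'] at hr ⊢
    obtain ⟨P, hP⟩ := exists_isPrimitive hw hf.1 hf.2
    obtain ⟨hi, h0⟩ := (hP.matching_iff hw hq hθ.1).1 hθ.2
    have hm : IsMatched (E M N) p q f P θ := ⟨hw, hP, hq, hi, hθ.1, h0⟩
    exact hlow f P θ r hm hpos ((hm.ofReal_le_variationalValue_iff r).1 hr.le)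

theorem normSq_weightedMeasure (hw : Weights (E M N) p q) (f : ℝ → ℝ) :
    normSq (weightedMeasure (E M N) p) f =
      ∫⁻ x in E M N, ENNReal.ofReal (p x * f x ^ 2) := by
  rw [normSq, lintegral_weightedMeasure hw.isOpen.measurableSet hw.contLeft]
  exact setLIntegral_congr_fun hw.isOpen.measurableSet fun x hx =>
    (ENNReal.ofReal_mul (hw.posLeft x hx).le).symm

theorem integrable_weightedMeasure_iff (hw : Weights (E M N) p q) (f : ℝ → ℝ) :
    (Integrable f (weightedMeasure (E M N) p) ↔ IntegrableOn (fun x => p x * f x) (E M N)) ∧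
      ∫ x, f x ∂weightedMeasure (E M N) p = ∫ x in E M N, p x * f x := by
  have hI := hw.isOpen.measurableSet
  have hm : AEMeasurable (fun x => ENNReal.ofReal (p x)) (volume.restrict (E M N)) :=
    (hw.contLeft.aemeasurable hI).ennreal_ofReal
  have htop : ∀ᵐ x ∂volume.restrict (E M N), ENNReal.ofReal (p x) < ∞ :=
    ae_of_all _ fun x => ENNReal.ofReal_lt_top
  have hae : (fun x => (ENNReal.ofReal (p x)).toReal • f x) =ᵐ[volume.restrict (E M N)]
      fun x => p x * f x := (ae_restrict_mem hI).mono fun x hx => by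
    simp only [ENNReal.toReal_ofReal (hw.posLeft x hx).le, smul_eq_mul]
  rw [weightedMeasure, integrable_withDensity_iff_integrable_smul₀' hm htop,
    integral_withDensity_eq_integral_toReal_smul₀ hm htop, integral_congr_ae hae]
  exact ⟨integrable_congr hae, rfl⟩

theorem integrableOn_sq_deriv_div (hw : Weights (E M N) p q) {g : ℝ → ℝ}
    (hfin : ∫⁻ x in E M N, ENNReal.ofReal (deriv g x ^ 2 / q x) ≠ ∞) :
    IntegrableOn (fun x => deriv g x ^ 2 / q x) (E M N) ∧
      ∫⁻ x in E M N, ENNReal.ofReal (deriv g x ^ 2 / q x) =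
        ENNReal.ofReal (∫ x in E M N, deriv g x ^ 2 / q x) := by
  have hI := hw.isOpen.measurableSet
  have h0 : 0 ≤ᵐ[volume.restrict (E M N)] fun x => deriv g x ^ 2 / q x :=
    (ae_restrict_mem hI).mono fun x hx => div_nonneg (sq_nonneg _) (hw.posRight x hx).le
  have hi : IntegrableOn (fun x => deriv g x ^ 2 / q x) (E M N) := by
    refine ⟨AEMeasurable.aestronglyMeasurable ?_, ?_⟩
    · exact ((measurable_deriv g).pow_const 2).aemeasurable.div (hw.contRight.aemeasurable hI)
    · rw [hasFiniteIntegral_iff_ofReal h0]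
      exact lt_top_iff_ne_top.2 hfin
  exact ⟨hi, (ofReal_integral_eq_lintegral_ofReal hi h0).symm⟩

theorem IsMatched.ofReal_le_dirichlet_energy {f P : ℝ → ℝ} {θ : ℝ}
    (h : IsMatched (E M N) p q f P θ) {lam : ℝ}
    (hle : ∀ z ∈ E M N, lam * matchFun (E M N) q P θ z ≤ f z) {g : ℝ → ℝ} (hg : g ∈ AC₀ M N)
    (hnorm : normSq (weightedMeasure (E M N) p) g = 1) :
    ENNReal.ofReal lam ≤ ∫⁻ x in E M N, ENNReal.ofReal (deriv g x ^ 2 / q x) := by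
  have hw := h.weights
  rcases eq_or_ne (∫⁻ x in E M N, ENNReal.ofReal (deriv g x ^ 2 / q x)) ∞ with htop | htop
  · rw [htop]; exact le_top
  obtain ⟨hi, he⟩ := integrableOn_sq_deriv_div hw htop
  obtain ⟨hgac, K, hK, hKI, hgK⟩ := hg
  have hgc := continuousOn_of_absolutelyContinuous hw.isOpen hgac
  -- An interval `[α, β]` whose end points lie outside of the support.
  have hK' : IsCompact (insert θ K) := hK.insert θ
  have hK'I : insert θ K ⊆ E M N := insert_subset h.mem hKI
  have hne : (insert θ K).Nonempty := ⟨θ, mem_insert _ _⟩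
  obtain ⟨α, hα, hαK⟩ := exists_mem_lt_of_isOpen hw.isOpen (hK'I (hK'.sInf_mem hne))
  obtain ⟨β, hβ, hβK⟩ := exists_mem_gt_of_isOpen hw.isOpen (hK'I (hK'.sSup_mem hne))
  have hlow : ∀ x ∈ K, α < x := fun x hx =>
    hαK.trans_le (csInf_le hK'.bddBelow (mem_insert_of_mem _ hx))
  have hhigh : ∀ x ∈ K, x < β := fun x hx =>
    (le_csSup hK'.bddAbove (mem_insert_of_mem _ hx)).trans_lt hβK
  have hαβ : α ≤ β := (hαK.trans_le ((csInf_le hK'.bddBelow (mem_insert _ _)).trans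
    (le_csSup hK'.bddAbove (mem_insert _ _)))).le.trans hβK.le
  have hb := h.dirichlet_bound hle hα hβ hαβ (hgac α hα β hβ)
    (hgK α ⟨hα, fun hk => (hlow α hk).false⟩) (hgK β ⟨hβ, fun hk => (hhigh β hk).false⟩) hi
  rw [normSq_weightedMeasure hw, lintegral_eq_ofReal_intervalIntegral
    (k := fun x => p x * g x ^ 2) hw.isOpen.measurableSet hw.ordConnected hα hβ hαβ
    (hw.contLeft.mul (hgc.pow 2))
    (fun x hx => mul_nonneg (hw.posLeft x hx).le (sq_nonneg _)) (fun x _ => rfl)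
    (fun x hx hout => by
      rw [hgK x ⟨hx, fun hk => ?_⟩]
      · simp
      · rcases hout with hlt | hlt
        · exact (hlow x hk).not_gt hlt
        · exact (hhigh x hk).not_gt hlt), ENNReal.ofReal_eq_one] at hnorm
  rw [hnorm, mul_one] at hb
  rw [he]
  exact ENNReal.ofReal_le_ofReal hb

theorem IsMatched.ofReal_le_neumann_energy {f P : ℝ → ℝ} {θ : ℝ}
    (h : IsMatched (E M N) p q f P θ) {lam : ℝ} (hlam : 0 < lam)
    (hle : ∀ z ∈ E M N, lam * matchFun (E M N) q P θ z ≤ f z) {g : ℝ → ℝ} (hg : g ∈ AC M N)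
    (hint : Integrable g (weightedMeasure (E M N) q))
    (hmean : ∫ x, g x ∂weightedMeasure (E M N) q = 0)
    (hnorm : normSq (weightedMeasure (E M N) q) g = 1) :
    ENNReal.ofReal lam ≤ ∫⁻ x in E M N, ENNReal.ofReal (deriv g x ^ 2 / p x) := by
  have hw := h.weights
  rcases eq_or_ne (∫⁻ x in E M N, ENNReal.ofReal (deriv g x ^ 2 / p x)) ∞ with htop | htop
  · rw [htop]; exact le_top
  obtain ⟨hi, he⟩ := integrableOn_sq_deriv_div hw.swap htop
  have hgc := continuousOn_of_absolutelyContinuous hw.isOpen hg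
  have h0 : ∀ x ∈ E M N, 0 ≤ q x * g x ^ 2 := fun x hx =>
    mul_nonneg (hw.posRight x hx).le (sq_nonneg _)
  rw [normSq_weightedMeasure hw.swap] at hnorm
  have h2 : IntegrableOn (fun x => q x * g x ^ 2) (E M N) := by
    rw [integrableOn_iff_lintegral_ofReal_lt_top (g := fun x => q x * g x ^ 2)
      hw.isOpen.measurableSet
      (hw.contRight.mul (hgc.pow 2)) h0]
    exact hnorm.trans_lt ENNReal.one_lt_top
  rw [← ofReal_integral_eq_lintegral_ofReal h2
    ((ae_restrict_mem hw.isOpen.measurableSet).mono h0), ENNReal.ofReal_eq_one] at hnorm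
  have hint' := (integrable_weightedMeasure_iff hw.swap g).1.1 hint
  rw [(integrable_weightedMeasure_iff hw.swap g).2] at hmean
  have hb := h.neumann_bound hlam hle hg hint' hmean h2 hi
  rw [hnorm, mul_one] at hb
  rw [he]
  exact ENNReal.ofReal_le_ofReal hb

/-! ### The weights of the diffusion -/

theorem isOpen_E (M N : EReal) : IsOpen (E M N) :=
  (isOpen_Ioo (a := -M) (b := N)).preimage continuous_coe_real_ereal

theorem ordConnected_E (M N : EReal) : (E M N).OrdConnected :=
  ⟨fun _ hx _ hy _ hz => ⟨hx.1.trans_le (EReal.coe_le_coe_iff.2 hz.1),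
    (EReal.coe_le_coe_iff.2 hz.2).trans_lt hy.2⟩⟩

variable {a b : ℝ → ℝ} {c : ℝ}

theorem weights_diffusion (ha : ContinuousOn a (E M N)) (hb : ContinuousOn b (E M N))
    (hpos : ∀ x ∈ E M N, 0 < a x) (hc : c ∈ E M N) :
    Weights (E M N) (fun x => Real.exp (C a b c x) / a x) (fun x => Real.exp (-C a b c x)) := by
  have hba : ContinuousOn (fun u => b u / a u) (E M N) := hb.div ha fun x hx => (hpos x hx).ne'
  have hC : ContinuousOn (C a b c) (E M N) := fun x hx =>
    (hasDerivAt_integral_of_continuousOn (isOpen_E M N) (ordConnected_E M N) hba hc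
      hx).continuousAt.continuousWithinAt
  exact
    { isOpen := isOpen_E M N
      ordConnected := ordConnected_E M N
      nonempty := ⟨c, hc⟩
      contLeft := hC.rexp.div ha fun x hx => (hpos x hx).ne'
      contRight := hC.neg.rexp
      posLeft := fun x hx => div_pos (Real.exp_pos _) (hpos x hx)
      posRight := fun x _ => Real.exp_pos _ }

theorem energy_eq (f : ℝ → ℝ) :
    energy M N a b c f =
      ∫⁻ x in E M N, ENNReal.ofReal (deriv f x ^ 2 / Real.exp (-C a b c x)) := by
  simp only [energy, Real.exp_neg, div_inv_eq_mul]

theorem lambdaDD_eq (ha : ContinuousOn a (E M N)) (hb : ContinuousOn b (E M N))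
    (hpos : ∀ x ∈ E M N, 0 < a x) (hc : c ∈ E M N)
    (hfin : scaleMeasure M N a b c (E M N) < ∞) :
    lambdaDD M N a b c =
      variationalSup M N (speedMeasure M N a b c) (scaleMeasure M N a b c) := by
  have hw := weights_diffusion ha hb hpos hc
  refine eq_variationalSup hw hfin (fun f P θ lam hm hlam hle => ?_) fun lam hlam hlt => ?_
  · refine le_sInf ?_
    rintro r ⟨g, hg, hnorm, rfl⟩
    rw [energy_eq]
    exact hm.ofReal_le_dirichlet_energy hle hg hnorm
  · by_contra hno
    obtain ⟨g, hg, hsupp, hnorm, hen⟩ := exists_dirichlet_test hw hlam hno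
    refine hlt.not_ge (le_trans (sInf_le ⟨g, ⟨fun x _ y _ => hg x y, hsupp⟩, ?_, rfl⟩) ?_)
    · exact (normSq_weightedMeasure hw g).trans hnorm
    · rwa [energy_eq]

theorem lambdaNN_eq (ha : ContinuousOn a (E M N)) (hb : ContinuousOn b (E M N))
    (hpos : ∀ x ∈ E M N, 0 < a x) (hc : c ∈ E M N)
    (hfin : speedMeasure M N a b c (E M N) < ∞) :
    lambdaNN M N a b c =
      variationalSup M N (scaleMeasure M N a b c) (speedMeasure M N a b c) := by
  have hw := (weights_diffusion ha hb hpos hc).swap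
  refine eq_variationalSup hw hfin (fun f P θ lam hm hlam hle => ?_) fun lam hlam hlt => ?_
  · refine le_sInf ?_
    rintro r ⟨g, hg, ⟨hint, hmean⟩, hnorm, rfl⟩
    rw [energy_eq]
    exact hm.ofReal_le_neumann_energy hlam hle hg hint hmean hnorm
  · by_contra hno
    have hq := (weightedMeasure_lt_top_iff hw.isOpen.measurableSet hw.contRight hw.posRight).1 hfin
    obtain ⟨g, hg, hint, hmean, hnorm, hen⟩ := exists_neumann_test hw hq hlam hno
    have hiff := integrable_weightedMeasure_iff hw.swap g
    refine hlt.not_ge (le_trans (sInf_le ⟨g, fun x _ y _ => hg x y,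
      ⟨hiff.1.2 hint, hiff.2.trans hmean⟩, ?_, rfl⟩) ?_)
    · exact (normSq_weightedMeasure hw.swap g).trans hnorm
    · rwa [energy_eq]

end OneDimDiffusion

theorem mainTheorem2 (M N : EReal) (hMN : -M < N) (a b : ℝ → ℝ)
    (ha : ContinuousOn a (OneDimDiffusion.E M N))
    (hb : ContinuousOn b (OneDimDiffusion.E M N))
    (hpos : ∀ x ∈ OneDimDiffusion.E M N, 0 < a x)
    (c : ℝ) (hc : c ∈ OneDimDiffusion.E M N)
    (μ ν : MeasureTheory.Measure ℝ)
    (hμ : μ = OneDimDiffusion.speedMeasure M N a b c)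
    (hν : ν = OneDimDiffusion.scaleMeasure M N a b c) :
    (ν (OneDimDiffusion.E M N) < ⊤ →
      (∀ f ∈ OneDimDiffusion.CPlus M N, OneDimDiffusion.HFinite M N μ ν f →
        ∃! θ : ℝ, OneDimDiffusion.IsMatchingPoint M N μ ν f θ) ∧
      OneDimDiffusion.lambdaDD M N a b c = OneDimDiffusion.variationalSup M N μ ν) ∧
    (μ (OneDimDiffusion.E M N) < ⊤ →
      (∀ f ∈ OneDimDiffusion.CPlus M N, OneDimDiffusion.HFinite M N ν μ f →
        ∃! θ : ℝ, OneDimDiffusion.IsMatchingPoint M N ν μ f θ) ∧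
      OneDimDiffusion.lambdaNN M N a b c = OneDimDiffusion.variationalSup M N ν μ) := by
  subst hμ hν
  have hw := OneDimDiffusion.weights_diffusion ha hb hpos hc
  exact ⟨fun hfin => ⟨fun f hf hF => OneDimDiffusion.existsUnique_isMatchingPoint hw hfin hf hF,
      OneDimDiffusion.lambdaDD_eq ha hb hpos hc hfin⟩,
    fun hfin => ⟨fun f hf hF => OneDimDiffusion.existsUnique_isMatchingPoint hw.swap hfin hf hF,
      OneDimDiffusion.lambdaNN_eq ha hb hpos hc hfin⟩⟩
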